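/- Let $\overline{\mathbb Q}$ be an algebraic closure of $\mathbb Q$ and let $Y$ be the set of places $y$ of $\overline{\mathbb Q}$, where $\|\cdot\|_y$ denotes the absolute value in $y$ that extends the usual archimedean absolute value or a usual $p$-adic absolute value of $\mathbb Q$. For a number field $k\subseteq\overline{\mathbb Q}$ and a place $v$ of $k$ let $Y(k,v)\subseteq Y$ be the set of places lying over $v$. Give $Y$ the (locally compact, Hausdorff, totally disconnected) topology with base consisting of all the sets $Y(k,v)$, and let $\lambda$ be the unique Borel measure on $Y$ with $\lambda(Y(k,v))=[k_v:\mathbb Q_v]/[k:\mathbb Q]$ for all $k$ and $v$. The group $\mathrm{Aut}(\overline{\mathbb Q}/\mathbb Q)$ acts on $Y$ by $\|\alpha\|_{\tau y}=\|\tau^{-1}\alpha\|_y$ and preserves $\lambda$. Let $$\mathcal X=\Big\{F\in L^1(Y,\lambda;\mathbb R):\int_Y F\,d\lambda=0\Big\},\qquad \mathcal G=\overline{\mathbb Q}^\times/\mathrm{Tor}(\overline{\mathbb Q}^\times),$$ where $\mathcal X$ carries the $L^1$-norm. For $\alpha\in\mathcal G$ let $f_\alpha\in\mathcal X$ be the function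 $f_\alpha(y)=\log\|\alpha\|_y$, and let $\mathcal F=\{f_\alpha:\alpha\in\mathcal G\}$, a $\mathbb Q$-linear subspace of $\mathcal X$. A subset $A\subseteq\mathcal F$ is called $\mathcal F$-closed if $A=\mathcal F\cap\overline A$, where $\overline A$ is the closure of $A$ in $\mathcal X$. Let $K$ be any field with $\mathbb Q\subseteq K\subseteq\overline{\mathbb Q}$. Let $\mathcal D_K\subseteq\mathcal F$ be the $\mathbb Q$-linear span of the functions $f_\alpha$ with $\alpha$ in the image of $K^\times$ in $\mathcal G$. Let $\nu_K$ be the Haar measure of total mass $1$ on the compact group $\mathrm{Aut}(\overline{\mathbb Q}/K)$, and let $U_K:\mathcal X\to\mathcal X$ be the continuous linear operator given by $$U_K(F)(y)=\int_{\mathrm{Aut}(\overline{\mathbb Q}/K)}F(\tau^{-1}y)\,d\nu_K(\tau)\quad\text{for }\lambda\text{-almost all }y\in Y.$$ Let $\mathcal X_K=U_K(\mathcal X)$ be the image of $U_K$, let $S_K$ be the restriction of $U_K$ to $\mathcal F$, and let $\mathcal E_K=\ker S_K=\{F\in\mathcal F:S_K(F)=0\}$. **Theorem.** $S_K$ is a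 continuous, $\mathbb Q$-linear projection of $\mathcal F$ onto $\mathcal D_K$ (that is, its image is $\mathcal D_K$ and it fixes every element of $\mathcal D_K$), and $$\mathcal F=\mathcal D_K\oplus\mathcal E_K.$$ Moreover $\overline{\mathcal D_K}=\mathcal X_K$, $\overline{\mathcal E_K}=\ker U_K$, and both $\mathcal D_K$ and $\mathcal E_K$ are $\mathcal F$-closed. For each $\beta\in\mathcal G$ the orbit $\mathrm{Orb}_K(\beta)=\{\tau\beta:\tau\in\mathrm{Aut}(\overline{\mathbb Q}/K)\}\subseteq\mathcal G$ is finite, and $$S_K(f_\beta)=\frac1{|\mathrm{Orb}_K(\beta)|}\sum_{\gamma\in\mathrm{Orb}_K(\beta)}f_\gamma .$$ -/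

import Mathlib

open MeasureTheory Topology

noncomputable section

namespace WeilHeight

/-! ### The field of algebraic numbers and its absolute Galois group -/

/-- The fixed algebraic closure of `ℚ`. -/
abbrev QBar : Type := AlgebraicClosure ℚ

instance : IsAlgClosure ℚ QBar where
  isAlgClosed := inferInstance
  isAlgebraic := by
    have h := AlgebraicClosure.isAlgebraic ℚ
    convert h
    · rfl
    · exact Subsingleton.elim _ _

/-- The profinite group `Aut(QBar/ℚ)`, with its Krull topology. For a subfield `K` of `QBar`, the
group `Aut(QBar/K)` is the closed subgroup `K.fixingSubgroup`, with the induced topology. -/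
abbrev GalQ : Type := QBar ≃ₐ[ℚ] QBar

instance : Countable QBar := by
  have := Algebra.IsAlgebraic.cardinalMk_le_max ℚ QBar
  rw [← Cardinal.mk_le_aleph0_iff]
  simpa using this

instance : SecondCountableTopology GalQ := by
  refine ⟨Set.range fun p : QBar × QBar => {g : GalQ | g p.1 = p.2}, Set.countable_range _, ?_⟩
  apply le_antisymm
  · refine le_generateFrom ?_
    rintro _ ⟨⟨a, b⟩, rfl⟩
    rw [isOpen_iff_mem_nhds]
    intro g hg
    have h := (stabilizer_isOpen_of_isIntegral (K := ℚ) a).leftCoset g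
    refine Filter.mem_of_superset (h.mem_nhds ⟨1, one_mem _, mul_one g⟩) ?_
    rintro _ ⟨s, hs, rfl⟩
    have hs' : s a = a := hs
    have hg' : g a = b := hg
    change g (s a) = b
    rw [hs', hg']
  · intro U hU
    rw [@isOpen_iff_mem_nhds _ (TopologicalSpace.generateFrom _)]
    intro g hg
    have h1 : (fun s => g * s) ⁻¹' U ∈ 𝓝 (1 : GalQ) :=
      (hU.preimage (continuous_const_mul g)).mem_nhds (by simpa using hg)
    obtain ⟨E, hE, hEU⟩ := (krullTopology_mem_nhds_one_iff ℚ QBar _).1 h1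
    obtain ⟨α, hα⟩ := @Field.exists_primitive_element ℚ E _ _ E.algebra' hE inferInstance
    have hV : IsOpen[TopologicalSpace.generateFrom
        (Set.range fun p : QBar × QBar => {g : GalQ | g p.1 = p.2})]
        {g' : GalQ | g' (α : QBar) = g α} :=
      TopologicalSpace.isOpen_generateFrom_of_mem ⟨(α, g α), rfl⟩
    refine Filter.mem_of_superset
      ((@mem_nhds_iff _ (TopologicalSpace.generateFrom _) _ _).2
        ⟨_, subset_rfl, hV, (rfl : g (α : QBar) = g α)⟩) ?_
    intro g' hg'
    have : g⁻¹ * g' ∈ E.fixingSubgroup := by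
      have hE : E = IntermediateField.adjoin ℚ {(α : QBar)} := by
        rw [← IntermediateField.lift_adjoin_simple, hα, IntermediateField.lift_top]
      have h2 : (g⁻¹ * g') (α : QBar) = α := by
        change g⁻¹ (g' α) = α
        rw [show g' (α : QBar) = g α from hg']
        exact g.symm_apply_apply _
      rw [IntermediateField.mem_fixingSubgroup_iff, hE]
      exact (IntermediateField.forall_mem_adjoin_smul_eq_self_iff ℚ (S := {(α : QBar)})
        (g⁻¹ * g')).2 (by simpa using h2)
    simpa using hEU this

/-! ### Places of the field of algebraic numbers -/

/-- A place `y` of `QBar`, given by its unique normalized representative `‖ ‖_y`: an absolute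
value on `QBar` whose restriction to `ℚ` is the usual absolute value or one of the usual `p`-adic
absolute values. (By Ostrowski's theorem each equivalence class of nontrivial absolute values on
`QBar` contains exactly one such representative.) -/
@[ext]
structure Place where
  abv : AbsoluteValue QBar ℝ
  normalized : (∀ q : ℚ, abv (algebraMap ℚ QBar q) = |(q : ℝ)|) ∨
    ∃ p : Nat.Primes, ∀ q : ℚ, abv (algebraMap ℚ QBar q) = (padicNorm (p : ℕ) q : ℝ)

/-- The set `Y(k, v)` of all places of `QBar` that lie over the place `v` of `k`, where `v` is the
restriction to `k` of the place `z` of `QBar`. -/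
def Place.over (k : IntermediateField ℚ QBar) (z : Place) : Set Place :=
  {y | ∀ a ∈ k, y.abv a = z.abv a}

/-- The topology on the set of places: the sets `Y(k, v)`, where `k` is a number field and `v` a
place of `k`, are a base. On each `Y(k, v)` this is the inverse limit topology of the
finite sets of places of `l` over `v`, for the finite extensions `l` of `k`. -/
instance : TopologicalSpace Place :=
  TopologicalSpace.generateFrom
    {s | ∃ (k : IntermediateField ℚ QBar) (z : Place), FiniteDimensional ℚ k ∧ s = Place.over k z}

instance : MeasurableSpace Place := borel Place
instance : BorelSpace Place := ⟨rfl⟩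
instance : MeasurableSpace GalQ := borel GalQ
instance : BorelSpace GalQ := ⟨rfl⟩

theorem Place.isOpen_over (k : IntermediateField ℚ QBar) [h : FiniteDimensional ℚ k] (z : Place) :
    IsOpen (Place.over k z) :=
  TopologicalSpace.isOpen_generateFrom_of_mem ⟨k, z, h, rfl⟩

/-- The action of `Aut(QBar/ℚ)` on places: `‖a‖_{τ y} = ‖τ⁻¹ a‖_y`. -/
instance : MulAction GalQ Place where
  smul τ y :=
    { abv := y.abv.comp (f := ((τ⁻¹ : GalQ) : QBar →+* QBar)) (τ⁻¹ : GalQ).injective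
      normalized := by
        have h : ∀ q : ℚ, y.abv.comp (f := ((τ⁻¹ : GalQ) : QBar →+* QBar)) (τ⁻¹ : GalQ).injective
            (algebraMap ℚ QBar q) = y.abv (algebraMap ℚ QBar q) :=
          fun q => congrArg y.abv ((τ⁻¹ : GalQ).commutes q)
        simp only [h]
        exact y.normalized }
  one_smul y := by ext a; rfl
  mul_smul σ τ y := by
    ext a
    change y.abv ((σ * τ)⁻¹ a) = y.abv (τ⁻¹ (σ⁻¹ a))
    rw [mul_inv_rev]; rfl

theorem Place.smul_abv (τ : GalQ) (y : Place) (a : QBar) : (τ • y).abv a = y.abv (τ⁻¹ a) := rfl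

instance : ContinuousSMul GalQ Place where
  continuous_smul := by
    refine continuous_generateFrom_iff.2 ?_
    rintro _ ⟨k, z, hk, rfl⟩
    rw [isOpen_iff_mem_nhds]
    rintro ⟨τ, y⟩ h
    have hfd : FiniteDimensional ℚ (k.map (τ⁻¹ : GalQ).toAlgHom) :=
      IntermediateField.finiteDimensional_map _
    have hopen := k.fixingSubgroup_isOpen.rightCoset τ
    refine Filter.mem_of_superset ((hopen.prod
      (Place.isOpen_over (k.map (τ⁻¹ : GalQ).toAlgHom) y)).mem_nhds
      ⟨⟨1, one_mem _, one_mul τ⟩, fun _ _ => rfl⟩) ?_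
    rintro ⟨_, w⟩ ⟨⟨s, hs, rfl⟩, hw⟩
    intro a ha
    rw [← h a ha]
    change w.abv ((s * τ)⁻¹ a) = y.abv (τ⁻¹ a)
    have hsa : s⁻¹ a = a :=
      (IntermediateField.mem_fixingSubgroup_iff k s⁻¹).1 (inv_mem hs) a ha
    have : (s * τ)⁻¹ a = τ⁻¹ a := by
      rw [mul_inv_rev]
      change τ⁻¹ (s⁻¹ a) = _
      rw [hsa]
    rw [this]
    exact hw _ ⟨a, ha, rfl⟩

/-! ### The measure on the space of places -/

/-- The Haar measure of total mass `1` on a compact group. -/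
def haarProb (G : Type*) [Group G] [TopologicalSpace G] [IsTopologicalGroup G] [CompactSpace G]
    [MeasurableSpace G] [BorelSpace G] : Measure G :=
  Measure.haarMeasure ⊤

section
variable (G : Type*) [Group G] [TopologicalSpace G] [IsTopologicalGroup G] [CompactSpace G]
    [MeasurableSpace G] [BorelSpace G]

instance : IsProbabilityMeasure (haarProb G) :=
  ⟨by simpa [haarProb] using
    Measure.haarMeasure_self (K₀ := (⊤ : TopologicalSpace.PositiveCompacts G))⟩

instance : (haarProb G).IsMulLeftInvariant := by
  unfold haarProb; infer_instance

end

/-- The absolute value of `QBar` induced by an embedding in `ℂ`. -/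
def archPlace : Place where
  abv := (NormedField.toAbsoluteValue ℂ).comp
    (f := ((IsAlgClosed.lift : QBar →ₐ[ℚ] ℂ) : QBar →+* ℂ)) (RingHom.injective _)
  normalized := by
    left
    intro q
    change ‖(IsAlgClosed.lift : QBar →ₐ[ℚ] ℂ) (algebraMap ℚ QBar q)‖ = _
    rw [AlgHom.commutes]
    simp

/-- The absolute value of `QBar` induced by an embedding in an algebraic closure of `ℚ_p`. -/
def padicPlace (p : Nat.Primes) : Place :=
  haveI : Fact (p : ℕ).Prime := ⟨p.2⟩
  { abv := (NormedField.toAbsoluteValue (PadicAlgCl p)).comp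
      (f := ((IsAlgClosed.lift : QBar →ₐ[ℚ] PadicAlgCl p) : QBar →+* PadicAlgCl p))
      (RingHom.injective _)
    normalized := by
      right
      refine ⟨p, fun q => ?_⟩
      change ‖(IsAlgClosed.lift : QBar →ₐ[ℚ] PadicAlgCl p) (algebraMap ℚ QBar q)‖ = _
      rw [AlgHom.commutes, IsScalarTower.algebraMap_apply ℚ ℚ_[p] (PadicAlgCl p),
        PadicAlgCl.norm_extends]
      simp }

/-- One place of `QBar` over each place `u` of `ℚ`; `none` is the archimedean place of `ℚ`. -/
def basePlace : Option Nat.Primes → Place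
  | none => archPlace
  | some p => padicPlace p

theorem measurable_orbit (y : Place) : Measurable fun g : GalQ => g • y :=
  (continuous_id.smul continuous_const).measurable

/-- The normalized Galois invariant Borel measure `λ` on the space of places. On the compact set
`Y(ℚ, u)`, which is a single orbit of `Aut(QBar/ℚ)`, it is the image of the normalized Haar
measure of `Aut(QBar/ℚ)` under the orbit map; this does not depend on the chosen place over `u`.
Of the `[k : ℚ]` embeddings of a number field `k` in `QBar`, exactly `[k_v : ℚ_v]` induce the place
`v` of `k`, therefore `λ (Y(k, v)) = [k_v : ℚ_v] / [k : ℚ]`. As the sets `Y(k, v)` are countable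
in number and any two of them meet in a finite disjoint union of such sets, `λ` is the only Borel
measure with these values. -/
def weilMeasure : Measure Place :=
  Measure.sum fun u : Option Nat.Primes => (haarProb GalQ).map fun g => g • basePlace u

instance : SFinite weilMeasure := by
  unfold weilMeasure; infer_instance

theorem measurePreserving_smul (τ : GalQ) :
    MeasurePreserving (fun y : Place => τ • y) weilMeasure weilMeasure := by
  have hm : Measurable fun y : Place => τ • y := (continuous_const_smul τ).measurable
  refine ⟨hm, ?_⟩
  unfold weilMeasure
  rw [Measure.map_sum hm.aemeasurable]
  congr 1
  funext u
  rw [Measure.map_map hm (measurable_orbit _)]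
  conv_rhs => rw [← map_mul_left_eq_self (haarProb GalQ) τ]
  rw [Measure.map_map (measurable_orbit _) (measurable_const_mul τ)]
  have h : (fun y : Place => τ • y) ∘ (fun g : GalQ => g • basePlace u) =
      (fun g : GalQ => g • basePlace u) ∘ (fun g => τ * g) :=
    funext fun g => (mul_smul τ g (basePlace u)).symm
  rw [h]

/-! ### The functions `f_α` -/

/-- The function `y ↦ log ‖a‖_y` on the space of places. -/
def logAbs (a : QBarˣ) (y : Place) : ℝ := Real.log (y.abv (a : QBar))

theorem logAbs_mul (a b : QBarˣ) : logAbs (a * b) = logAbs a + logAbs b := by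
  funext y
  simp only [logAbs, Units.val_mul, map_mul, Pi.add_apply]
  exact Real.log_mul (y.abv.ne_zero a.ne_zero) (y.abv.ne_zero b.ne_zero)

theorem logAbs_one : logAbs 1 = 0 := by
  funext y; simp [logAbs]

theorem logAbs_smul (τ : GalQ) (a : QBarˣ) (y : Place) :
    logAbs (τ • a) y = logAbs a (τ⁻¹ • y) := by
  simp only [logAbs, Place.smul_abv, inv_inv, AlgEquiv.smul_units_def]
  rfl

theorem continuous_logAbs (a : QBarˣ) : Continuous (logAbs a) := by
  rw [continuous_iff_continuousAt]
  intro y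
  have hfd : FiniteDimensional ℚ (IntermediateField.adjoin ℚ {(a : QBar)}) :=
    IntermediateField.adjoin.finiteDimensional (Algebra.IsIntegral.isIntegral _)
  have h : logAbs a =ᶠ[𝓝 y] fun _ => logAbs a y := by
    refine Filter.mem_of_superset ((Place.isOpen_over
      (IntermediateField.adjoin ℚ {(a : QBar)}) y).mem_nhds fun _ _ => rfl) ?_
    intro z hz
    change Real.log _ = Real.log _
    rw [hz _ (IntermediateField.mem_adjoin_simple_self ℚ _)]
  exact continuousAt_const.congr h.symm

theorem integrable_map_logAbs (a : QBarˣ) (y : Place) :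
    Integrable (logAbs a) ((haarProb GalQ).map fun g => g • y) := by
  rw [integrable_map_measure (continuous_logAbs a).aestronglyMeasurable
    (measurable_orbit y).aemeasurable]
  exact ((continuous_logAbs a).comp (continuous_id.smul continuous_const)).integrable_of_hasCompactSupport
    (HasCompactSupport.of_compactSpace _)

theorem padicPlace_rat (p : Nat.Primes) (q : ℚ) :
    (padicPlace p).abv (algebraMap ℚ QBar q) = (padicNorm (p : ℕ) q : ℝ) := by
  have : Fact (p : ℕ).Prime := ⟨p.2⟩
  change ‖(IsAlgClosed.lift : QBar →ₐ[ℚ] PadicAlgCl p) (algebraMap ℚ QBar q)‖ = _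
  rw [AlgHom.commutes, IsScalarTower.algebraMap_apply ℚ ℚ_[p] (PadicAlgCl p),
    PadicAlgCl.norm_extends]
  simp

theorem archPlace_rat (q : ℚ) : archPlace.abv (algebraMap ℚ QBar q) = |(q : ℝ)| := by
  change ‖(IsAlgClosed.lift : QBar →ₐ[ℚ] ℂ) (algebraMap ℚ QBar q)‖ = _
  rw [AlgHom.commutes]
  simp

theorem padicPlace_le_one (p : Nat.Primes) {x : QBar} (hx : IsIntegral ℤ x) :
    (padicPlace p).abv x ≤ 1 := by
  have : Fact (p : ℕ).Prime := ⟨p.2⟩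
  have h : IsIntegral ℤ ((IsAlgClosed.lift : QBar →ₐ[ℚ] PadicAlgCl p) x) :=
    hx.map ((IsAlgClosed.lift : QBar →ₐ[ℚ] PadicAlgCl p) : QBar →+* PadicAlgCl p).toIntAlgHom
  have h2 := (Valuation.integer.integers (PadicAlgCl.valued (p : ℕ)).v).mem_of_integral
    (h.tower_top)
  have h3 : ‖(IsAlgClosed.lift : QBar →ₐ[ℚ] PadicAlgCl p) x‖₊ ≤ 1 := h2
  exact h3

theorem finite_padicPlace_gt_one (a : QBarˣ) :
    {p : Nat.Primes | ∃ g : GalQ, 1 < (padicPlace p).abv (g (a : QBar))}.Finite := by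
  obtain ⟨N, hN0, hN⟩ := IsAlgebraic.exists_integral_multiple
    ((IsFractionRing.isAlgebraic_iff ℤ ℚ QBar).2 (Algebra.IsAlgebraic.isAlgebraic (R := ℚ) (a : QBar)))
  have hfin : {p : Nat.Primes | (p : ℕ) ∣ N.natAbs}.Finite :=
    Set.Finite.preimage (f := fun p : Nat.Primes => (p : ℕ)) (s := {n | n ∣ N.natAbs})
      (Subtype.val_injective.injOn) ((Set.finite_le_nat N.natAbs).subset fun n hn => Nat.le_of_dvd (Int.natAbs_pos.2 hN0) hn)
  refine hfin.subset ?_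
  rintro p ⟨g, hg⟩
  have : Fact (p : ℕ).Prime := ⟨p.2⟩
  by_contra hp
  have h1 : IsIntegral ℤ (g (N • (a : QBar))) :=
    hN.map (g : QBar →+* QBar).toIntAlgHom
  have h2 := padicPlace_le_one p h1
  rw [map_zsmul, zsmul_eq_mul, map_mul,
    show ((N : ℤ) : QBar) = algebraMap ℚ QBar (N : ℚ) by simp, padicPlace_rat] at h2
  have h3 : padicNorm (p : ℕ) (N : ℚ) = 1 := by
    rw [padicNorm.int_eq_one_iff]
    rwa [Int.natCast_dvd]
  rw [h3] at h2
  simp at h2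
  exact absurd hg (not_lt.2 h2)

theorem integrable_logAbs (a : QBarˣ) : Integrable (logAbs a) weilMeasure := by
  refine integrable_sum_measure (fun u => integrable_map_logAbs a _) ?_
  have hf := (finite_padicPlace_gt_one a).union (finite_padicPlace_gt_one a⁻¹)
  refine summable_of_hasFiniteSupport (((hf.image some).insert none).subset ?_)
  intro u hu
  cases u with
  | none => simp
  | some p =>
    refine Set.mem_insert_of_mem _ ⟨p, ?_, rfl⟩
    by_contra hp
    apply hu
    simp only [Set.mem_union, Set.mem_ofPred_eq, not_or, not_exists, not_lt] at hp
    change ∫ y, ‖logAbs a y‖ ∂((haarProb GalQ).map fun g => g • padicPlace p) = 0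
    rw [integral_map (measurable_orbit _).aemeasurable
      (continuous_logAbs a).norm.aestronglyMeasurable]
    have h0 : ∀ g : GalQ, logAbs a (g • padicPlace p) = 0 := by
      intro g
      have e1 := hp.1 g⁻¹
      have e2 := hp.2 g⁻¹
      rw [Units.val_inv_eq_inv_val, map_inv₀, map_inv₀] at e2
      have hpos : 0 < (padicPlace p).abv (g⁻¹ (a : QBar)) :=
        (padicPlace p).abv.pos (by simp)
      have e3 : (padicPlace p).abv (g⁻¹ (a : QBar)) = 1 :=
        le_antisymm e1 ((inv_le_one₀ hpos).1 e2)
      change Real.log ((padicPlace p).abv (g⁻¹ (a : QBar))) = 0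
      rw [e3, Real.log_one]
    simp [h0]

theorem integral_logAbs_mul (a b : QBarˣ) : ∫ y, logAbs (a * b) y ∂weilMeasure =
    ∫ y, logAbs a y ∂weilMeasure + ∫ y, logAbs b y ∂weilMeasure := by
  rw [logAbs_mul]
  exact integral_add (integrable_logAbs a) (integrable_logAbs b)

theorem integral_logAbs_smul (τ : GalQ) (a : QBarˣ) :
    ∫ y, logAbs (τ • a) y ∂weilMeasure = ∫ y, logAbs a y ∂weilMeasure := by
  simp only [logAbs_smul]
  exact (measurePreserving_smul τ⁻¹).integral_comp
    (Homeomorph.smul τ⁻¹).measurableEmbedding (logAbs a)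

/-- The integral of `log ‖a‖_y` as a homomorphism. -/
def intLog : QBarˣ →* Multiplicative ℝ where
  toFun a := Multiplicative.ofAdd (∫ y, logAbs a y ∂weilMeasure)
  map_one' := by simp [logAbs_one]
  map_mul' a b := by rw [integral_logAbs_mul]; rfl

theorem integral_logAbs_rat (a : QBarˣ) (q : ℚ) (hq : (a : QBar) = algebraMap ℚ QBar q) :
    ∫ y, logAbs a y ∂weilMeasure =
      ∑' u : Option Nat.Primes, Real.log ((basePlace u).abv (algebraMap ℚ QBar q)) := by
  rw [weilMeasure, integral_sum_measure (integrable_logAbs a)]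
  congr 1
  funext u
  rw [integral_map (measurable_orbit _).aemeasurable (continuous_logAbs a).aestronglyMeasurable]
  have : ∀ g : GalQ, logAbs a (g • basePlace u) =
      Real.log ((basePlace u).abv (algebraMap ℚ QBar q)) := by
    intro g
    change Real.log ((basePlace u).abv (g⁻¹ (a : QBar))) = _
    rw [hq, AlgEquiv.commutes]
  simp [this]

theorem intLog_prime (p : Nat.Primes) (a : QBarˣ) (ha : (a : QBar) = (p : ℕ)) :
    intLog a = 1 := by
  have : Fact (p : ℕ).Prime := ⟨p.2⟩
  change ∫ y, logAbs a y ∂weilMeasure = 0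
  rw [integral_logAbs_rat a (p : ℕ) (by simp [ha]), tsum_eq_sum (s := {none, some p}),
    Finset.sum_pair (by simp)]
  · have h1 : padicNorm p ((p : ℕ) : ℚ) = ((p : ℕ) : ℚ)⁻¹ := padicNorm.padicNorm_p_of_prime
    simp only [basePlace, archPlace_rat, padicPlace_rat, h1]
    simp
  · intro u hu
    cases u with
    | none => simp at hu
    | some r =>
      have : Fact (r : ℕ).Prime := ⟨r.2⟩
      simp only [basePlace, padicPlace_rat]
      have hne : (r : ℕ) ≠ p := by
        rintro h
        apply hu
        simp [show r = p from Subtype.ext h]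
      rw [padicNorm.padicNorm_of_prime_of_ne hne]
      simp

theorem intLog_nat (n : ℕ) (a : QBarˣ) (ha : (a : QBar) = n) : intLog a = 1 := by
  induction n using Nat.recOnMul generalizing a with
  | zero => exact absurd ha (by simp)
  | one =>
    have : a = 1 := Units.ext (by simpa using ha)
    rw [this, map_one]
  | prime p hp => exact intLog_prime ⟨p, hp⟩ a ha
  | mul m n hm hn =>
    have h0 : (m : QBar) * n ≠ 0 := by
      rw [← Nat.cast_mul, ← ha]; exact a.ne_zero
    have : a = Units.mk0 (m : QBar) (left_ne_zero_of_mul h0) *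
        Units.mk0 (n : QBar) (right_ne_zero_of_mul h0) := Units.ext (by simpa using ha)
    rw [this, map_mul, hm _ rfl, hn _ rfl, one_mul]

theorem intLog_neg_one : intLog (-1) = 1 := by
  change ∫ y, logAbs (-1) y ∂weilMeasure = 0
  simp [logAbs]

theorem intLog_int (n : ℤ) (a : QBarˣ) (ha : (a : QBar) = n) : intLog a = 1 := by
  obtain ⟨m, rfl | rfl⟩ := n.eq_nat_or_neg
  · exact intLog_nat m a (by simpa using ha)
  · have h := intLog_nat m (-1 * a) (by simp [ha])
    rwa [map_mul, intLog_neg_one, one_mul] at h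

theorem intLog_rat (q : ℚ) (a : QBarˣ) (ha : (a : QBar) = algebraMap ℚ QBar q) :
    intLog a = 1 := by
  have hd : (q.den : QBar) ≠ 0 := by exact_mod_cast q.den_ne_zero
  have h1 := intLog_nat q.den (Units.mk0 _ hd) rfl
  have h2 := intLog_int q.num (a * Units.mk0 _ hd) (by
    rw [Units.val_mul, Units.val_mk0, ha]
    rw [← map_natCast (algebraMap ℚ QBar), ← map_mul, Rat.mul_den_eq_num, map_intCast])
  rwa [map_mul, h1, mul_one] at h2

theorem finite_orbit (a : QBarˣ) : (MulAction.orbit GalQ a).Finite := by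
  have h0 : minpoly ℚ (a : QBar) ≠ 0 := minpoly.ne_zero (Algebra.IsIntegral.isIntegral _)
  refine Set.Finite.of_finite_image (f := fun b : QBarˣ => (b : QBar)) (Set.Finite.subset
    (Polynomial.rootSet_finite (minpoly ℚ (a : QBar)) QBar) ?_) Units.val_injective.injOn
  rintro _ ⟨_, ⟨g, rfl⟩, rfl⟩
  rw [Polynomial.mem_rootSet]
  refine ⟨h0, ?_⟩
  change Polynomial.aeval (g (a : QBar)) _ = 0
  have := Polynomial.aeval_algHom_apply (g : QBar →ₐ[ℚ] QBar) (a : QBar) (minpoly ℚ (a : QBar))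
  simpa using this

/-- The product formula. -/
theorem integral_logAbs (a : QBarˣ) : ∫ y, logAbs a y ∂weilMeasure = 0 := by
  have hfin := finite_orbit a
  set S : Finset QBarˣ := hfin.toFinset with hS
  have hmem : ∀ b, b ∈ S ↔ ∃ g : GalQ, g • a = b := fun b => by
    rw [hS, Set.Finite.mem_toFinset]; rfl
  have hfix : ∀ g : GalQ, g • (∏ b ∈ S, b) = ∏ b ∈ S, b := by
    intro g
    rw [Finset.smul_prod']
    refine Finset.prod_bij (fun b _ => g • b) ?_ ?_ ?_ ?_
    · intro b hb
      obtain ⟨h, rfl⟩ := (hmem b).1 hb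
      exact (hmem _).2 ⟨g * h, mul_smul g h a⟩
    · intro b _ c _ h
      exact smul_left_cancel g h
    · intro b hb
      obtain ⟨h, rfl⟩ := (hmem b).1 hb
      exact ⟨(g⁻¹ * h) • a, (hmem _).2 ⟨_, rfl⟩, by rw [← mul_smul]; simp⟩
    · intro b _; rfl
  obtain ⟨q, hq⟩ := IntermediateField.mem_bot.1
    ((InfiniteGalois.mem_bot_iff_fixed (k := ℚ) ((∏ b ∈ S, b : QBarˣ) : QBar)).2
      fun g => congrArg Units.val (hfix g))
  have h1 := intLog_rat q (∏ b ∈ S, b) hq.symm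
  have h2 : ∀ b ∈ S, intLog b = intLog a := by
    intro b hb
    obtain ⟨g, rfl⟩ := (hmem b).1 hb
    exact congrArg Multiplicative.ofAdd (integral_logAbs_smul g a)
  rw [map_prod, Finset.prod_congr rfl h2, Finset.prod_const] at h1
  have h3 : S.card • (∫ y, logAbs a y ∂weilMeasure) = 0 := h1
  have hc : S.card ≠ 0 := Finset.card_ne_zero.2 ⟨a, (hmem a).2 ⟨1, one_smul _ a⟩⟩
  exact (smul_eq_zero.1 h3).resolve_left hc

/-! ### The Banach space `X` and the `ℚ`-vector space `F` -/

/-- The Banach space of all `F` in `L¹(Y, λ)` whose integral is `0`, with the `L¹`-norm. -/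
def XSpace : Submodule ℝ (Lp ℝ 1 weilMeasure) where
  carrier := {F | ∫ y, F y ∂weilMeasure = 0}
  zero_mem' := by
    change ∫ y, (0 : Lp ℝ 1 weilMeasure) y ∂weilMeasure = 0
    rw [integral_congr_ae (Lp.coeFn_zero ℝ 1 weilMeasure)]
    simp
  add_mem' := by
    intro F H hF hH
    change ∫ y, (F + H : Lp ℝ 1 weilMeasure) y ∂weilMeasure = 0
    rw [integral_congr_ae (Lp.coeFn_add F H)]
    have h := integral_add (L1.integrable_coeFn F) (L1.integrable_coeFn H)
    rw [show ∫ y, F y ∂weilMeasure = 0 from hF, show ∫ y, H y ∂weilMeasure = 0 from hH,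
      add_zero] at h
    exact h
  smul_mem' := by
    intro c F hF
    change ∫ y, (c • F : Lp ℝ 1 weilMeasure) y ∂weilMeasure = 0
    rw [integral_congr_ae (Lp.coeFn_smul c F)]
    have h := integral_const_mul (μ := weilMeasure) c (fun y => F y)
    rw [show ∫ y, F y ∂weilMeasure = 0 from hF, mul_zero] at h
    exact h

theorem mem_XSpace (F : Lp ℝ 1 weilMeasure) : F ∈ XSpace ↔ ∫ y, F y ∂weilMeasure = 0 := Iff.rfl

/-- The group `QBarˣ / Tor(QBarˣ)`, written multiplicatively. -/
abbrev G : Type := QBarˣ ⧸ CommGroup.torsion QBarˣ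

/-- The homomorphism `a ↦ f_a` from `QBarˣ` to the additive group of `X`, where
`f_a(y) = log ‖a‖_y`. -/
def logVec : QBarˣ →* Multiplicative XSpace where
  toFun a := Multiplicative.ofAdd ⟨(integrable_logAbs a).toL1 (logAbs a), by
    rw [mem_XSpace, integral_congr_ae (integrable_logAbs a).coeFn_toL1]
    exact integral_logAbs a⟩
  map_one' := by
    refine congrArg Multiplicative.ofAdd (Subtype.ext ?_)
    simp only [logAbs_one]
    exact Integrable.toL1_zero _
  map_mul' a b := by
    refine congrArg Multiplicative.ofAdd (Subtype.ext ?_)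
    simp only [logAbs_mul]
    exact Integrable.toL1_add _ _ (integrable_logAbs a) (integrable_logAbs b)

/-- The element `f_α` of `X`, for `α` in the group `G`. -/
def fVec (α : G) : XSpace :=
  Multiplicative.toAdd (QuotientGroup.lift (CommGroup.torsion QBarˣ) logVec (by
    intro a ha
    obtain ⟨n, hn, h⟩ := isOfFinOrder_iff_pow_eq_one.1 ((CommGroup.mem_torsion _).1 ha)
    have h1 : (n : ℝ) • Multiplicative.toAdd (logVec a) = 0 := by
      rw [Nat.cast_smul_eq_nsmul, ← toAdd_pow, ← map_pow, h, map_one, toAdd_one]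
    exact (smul_eq_zero.1 h1).resolve_left (Nat.cast_ne_zero.2 hn.ne')) α)

theorem fVec_mk (a : QBarˣ) :
    ((fVec (a : G) : XSpace) : Lp ℝ 1 weilMeasure) = (integrable_logAbs a).toL1 (logAbs a) := rfl

theorem fVec_one : fVec 1 = 0 := by
  simp [fVec]

theorem fVec_mul (α β : G) : fVec (α * β) = fVec α + fVec β := by
  simp [fVec]

theorem fVec_pow (α : G) (n : ℕ) : fVec (α ^ n) = n • fVec α := by
  simp [fVec]

theorem fVec_zpow (α : G) (n : ℤ) : fVec (α ^ n) = n • fVec α := by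
  simp [fVec]

theorem exists_pow_eq (α : G) (n : ℕ) (hn : n ≠ 0) : ∃ β : G, β ^ n = α := by
  obtain ⟨a, rfl⟩ := QuotientGroup.mk_surjective α
  obtain ⟨b, hb⟩ := IsAlgClosed.exists_pow_nat_eq (a : QBar) (Nat.pos_of_ne_zero hn)
  have hb0 : b ≠ 0 := by
    rintro rfl
    rw [zero_pow hn] at hb
    exact a.ne_zero hb.symm
  refine ⟨(Units.mk0 b hb0 : QBarˣ), ?_⟩
  rw [← QuotientGroup.mk_pow]
  exact congrArg _ (Units.ext (by simpa using hb))

/-- The `ℚ`-vector space of all functions `f_α`. -/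
def FSpace : Submodule ℚ XSpace where
  carrier := Set.range fVec
  zero_mem' := ⟨1, fVec_one⟩
  add_mem' := by
    rintro _ _ ⟨α, rfl⟩ ⟨β, rfl⟩
    exact ⟨α * β, fVec_mul α β⟩
  smul_mem' := by
    rintro q _ ⟨α, rfl⟩
    obtain ⟨β, hβ⟩ := exists_pow_eq (α ^ q.num) q.den q.den_ne_zero
    refine ⟨β, ?_⟩
    have h : (q.den : ℚ) • fVec β = (q.num : ℚ) • fVec α := by
      rw [Nat.cast_smul_eq_nsmul, Int.cast_smul_eq_zsmul, ← fVec_pow, hβ, fVec_zpow]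
    have hd : (q.den : ℚ) ≠ 0 := by exact_mod_cast q.den_ne_zero
    rw [← inv_smul_smul₀ hd (fVec β), h, smul_smul, inv_mul_eq_div, Rat.num_div_den]

theorem fVec_mem (α : G) : fVec α ∈ FSpace := ⟨α, rfl⟩

/-- A subset `A` of `F` is `F`-closed if `A = F ∩ closure A`, the closure being taken in `X`. -/
def IsFClosed (A : Set XSpace) : Prop := A = (FSpace : Set XSpace) ∩ closure A

/-- The action of an automorphism on `G`. -/
def galG (τ : GalQ) : G →* G :=
  QuotientGroup.map _ _ (MulDistribMulAction.toMonoidHom QBarˣ τ) (by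
    intro a ha
    exact (MulDistribMulAction.toMonoidHom QBarˣ τ).isOfFinOrder ha)

/-- The orbit of `β` in `G` under the action of `Aut(QBar/K)`. -/
def orbit (K : IntermediateField ℚ QBar) (β : G) : Set G :=
  {γ | ∃ τ ∈ K.fixingSubgroup, γ = galG τ β}

/-- The image of `Kˣ` in `G`. -/
def GK (K : IntermediateField ℚ QBar) : Set G :=
  {γ | ∃ a : QBarˣ, (a : QBar) ∈ K ∧ γ = (a : G)}

/-- The `ℚ`-linear subspace generated by the functions `f_α` with `α` in the image of `Kˣ`. -/
def DSpace (K : IntermediateField ℚ QBar) : Submodule ℚ XSpace :=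
  Submodule.span ℚ (fVec '' GK K)

/-! ### The averaging operator `U_K` -/

section
variable (K : IntermediateField ℚ QBar)

instance : CompactSpace K.fixingSubgroup :=
  isCompact_iff_compactSpace.1 (InfiniteGalois.fixingSubgroup_isClosed K).isCompact

/-- The normalized Haar measure of `Aut(QBar/K)`. -/
def nuK : Measure K.fixingSubgroup := haarProb K.fixingSubgroup

instance : IsProbabilityMeasure (nuK K) := by
  unfold nuK; infer_instance

/-- The function `y ↦ ∫ F(τ⁻¹ y) dν_K(τ)`, the integral being over `Aut(QBar/K)`. -/
def average (F : Place → ℝ) (y : Place) : ℝ :=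
  ∫ τ : K.fixingSubgroup, F ((τ : GalQ)⁻¹ • y) ∂nuK K

theorem measurePreserving_shear :
    MeasurePreserving (fun p : Place × K.fixingSubgroup => ((p.2 : GalQ)⁻¹ • p.1))
      (weilMeasure.prod (nuK K)) weilMeasure := by
  have hm : Measurable (Function.uncurry fun (τ : K.fixingSubgroup) (y : Place) =>
      (τ : GalQ)⁻¹ • y) := by
    have : SecondCountableTopology K.fixingSubgroup :=
      TopologicalSpace.Subtype.secondCountableTopology (K.fixingSubgroup : Set GalQ)
    have h : Continuous (Function.uncurry fun (τ : K.fixingSubgroup) (y : Place) =>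
        (τ : GalQ)⁻¹ • y) :=
      ((continuous_subtype_val.comp continuous_fst).inv).smul continuous_snd
    exact h.measurable
  have h1 := (MeasurePreserving.id (nuK K)).skew_product hm
    (Filter.Eventually.of_forall fun τ => (measurePreserving_smul (τ : GalQ)⁻¹).map_eq)
  exact (measurePreserving_snd.comp h1).comp Measure.measurePreserving_swap

theorem integrable_shear {F : Place → ℝ} (hF : Integrable F weilMeasure) :
    Integrable (fun p : Place × K.fixingSubgroup => F ((p.2 : GalQ)⁻¹ • p.1))
      (weilMeasure.prod (nuK K)) :=
  (measurePreserving_shear K).integrable_comp_of_integrable hF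

theorem integrable_average {F : Place → ℝ} (hF : Integrable F weilMeasure) :
    Integrable (average K F) weilMeasure :=
  (integrable_shear K hF).integral_prod_left

theorem average_congr {F H : Place → ℝ} (h : F =ᵐ[weilMeasure] H) :
    average K F =ᵐ[weilMeasure] average K H := by
  have h1 := Measure.ae_ae_of_ae_prod ((measurePreserving_shear K).quasiMeasurePreserving.ae h)
  filter_upwards [h1] with y hy
  exact integral_congr_ae hy

theorem average_add {F H : Place → ℝ} (hF : Integrable F weilMeasure)
    (hH : Integrable H weilMeasure) :
    average K (F + H) =ᵐ[weilMeasure] average K F + average K H := by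
  filter_upwards [(integrable_shear K hF).prod_right_ae, (integrable_shear K hH).prod_right_ae]
    with y h1 h2
  exact integral_add h1 h2

theorem average_smul (c : ℝ) (F : Place → ℝ) : average K (c • F) = c • average K F := by
  funext y
  exact integral_const_mul c _

theorem integral_average {F : Place → ℝ} (hF : Integrable F weilMeasure) :
    ∫ y, average K F y ∂weilMeasure = ∫ y, F y ∂weilMeasure := by
  have h1 := integral_integral_swap (f := fun (y : Place) (τ : K.fixingSubgroup) =>
    F ((τ : GalQ)⁻¹ • y)) (integrable_shear K hF)
  refine h1.trans ?_
  have h2 : ∀ τ : K.fixingSubgroup, ∫ y, F ((τ : GalQ)⁻¹ • y) ∂weilMeasure =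
      ∫ y, F y ∂weilMeasure := fun τ =>
    (measurePreserving_smul (τ : GalQ)⁻¹).integral_comp
      (Homeomorph.smul (τ : GalQ)⁻¹).measurableEmbedding F
  simp [h2]

/-- The operator `U_K : X → X`, where `U_K(F)(y) = ∫ F(τ⁻¹ y) dν_K(τ)` for almost all `y`, the
integral being over `Aut(QBar/K)`. -/
def UOp : XSpace →L[ℝ] XSpace :=
  LinearMap.mkContinuous
    { toFun := fun F => ⟨(integrable_average K (L1.integrable_coeFn F.1)).toL1 (average K F.1), by
        rw [mem_XSpace, integral_congr_ae (Integrable.coeFn_toL1 _),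
          integral_average K (L1.integrable_coeFn F.1)]
        exact F.2⟩
      map_add' := by
        intro F H
        refine Subtype.ext ?_
        have hF := L1.integrable_coeFn F.1
        have hH := L1.integrable_coeFn H.1
        refine Eq.trans ?_ (Integrable.toL1_add _ _ (integrable_average K hF)
          (integrable_average K hH))
        rw [Integrable.toL1_eq_toL1_iff]
        exact (average_congr K (Lp.coeFn_add F.1 H.1)).trans (average_add K hF hH)
      map_smul' := by
        intro c F
        refine Subtype.ext ?_
        have hF := L1.integrable_coeFn F.1
        refine Eq.trans ?_ (Integrable.toL1_smul _ (integrable_average K hF) c)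
        rw [Integrable.toL1_eq_toL1_iff]
        refine (average_congr K (Lp.coeFn_smul c F.1)).trans ?_
        rw [average_smul]
        rfl }
    1 (by
      intro F
      have hF := L1.integrable_coeFn F.1
      rw [one_mul]
      change ‖(integrable_average K hF).toL1 (average K F.1)‖ ≤ ‖F.1‖
      have e : ∫ y, ‖(integrable_average K hF).toL1 (average K F.1) y‖ ∂weilMeasure =
          ∫ y, ‖average K F.1 y‖ ∂weilMeasure := by
        refine integral_congr_ae ?_
        filter_upwards [Integrable.coeFn_toL1 (integrable_average K hF)] with y hy
        rw [hy]
      rw [L1.norm_eq_integral_norm, L1.norm_eq_integral_norm, ← integral_average K hF.norm, e]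
      refine integral_mono (integrable_average K hF).norm (integrable_average K hF.norm) ?_
      intro y
      exact norm_integral_le_integral_norm _)

/-- The restriction `S_K` of `U_K` to the `ℚ`-vector space `F`. -/
def SOp : FSpace →ₗ[ℚ] XSpace :=
  ((UOp K).toLinearMap.restrictScalars ℚ).domRestrict FSpace

/-- The kernel of `S_K`, as a `ℚ`-linear subspace of `X` (contained in `F`). -/
def ESpace : Submodule ℚ XSpace := (LinearMap.ker (SOp K)).map FSpace.subtype

end

end WeilHeight

end

open WeilHeight

namespace WeilHeight

/-! ### Averages over finite orbits of a compact group -/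

/-! The proof has an algebraic half and an analytic half.

Algebra: an algebraic number `a` has a finite orbit under Aut(QBar/K), and Haar measure gives every
point of the orbit the same mass. So `U_K` sends `f_a` to the mean of the `f_b` over the n
conjugates `b`, which is 1/n times `f` of their product. That product is Galois invariant, hence
lies in `K`. Thus `U_K` maps F into `D_K` and is the identity on `D_K` (`UOp_fVec_mem`,
`UOp_of_mem_DSpace`). This yields the projection, the direct sum and, by continuity of `U_K`, the
F-closedness. The same averaging over the orbit modulo torsion gives the formula for `S_K`.

Analysis: the two closure statements follow once F is dense in X (`closure_FSpace`), because `U_K`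
and 1 - `U_K` are continuous. For density, the closure of F is a real subspace, and indicators of
the sets Y(k, v) span a dense subspace of L¹. Each such indicator, corrected by a multiple of the
indicator of the archimedean places to have integral 0, must be a limit of elements of F.

For archimedean v, Minkowski's theorem supplies integers `a` of `k` with log|a|_w ≤ n x_w + C at
every archimedean w, where C does not depend on n. The product formula turns these one-sided bounds
into an L¹ bound, so (1/n) `f_a` tends to the function with values x_w. For non-archimedean v, a
power of the prime ideal is principal by finiteness of the class group. The function of a generator
is supported on Y(k, v) and the archimedean places, and its archimedean part is already known to be
admissible. -/

theorem integral_orbit_eq_average {Γ Ω : Type*} [Group Γ] [TopologicalSpace Γ]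
    [IsTopologicalGroup Γ] [CompactSpace Γ] [MeasurableSpace Γ] [BorelSpace Γ] [MulAction Γ Ω]
    (b : Ω) (hfin : (MulAction.orbit Γ b).Finite)
    (hmeas : ∀ c, MeasurableSet {τ : Γ | τ • b = c}) (φ : Ω → ℝ) :
    ∫ τ : Γ, φ (τ • b) ∂haarProb Γ =
      (hfin.toFinset.card : ℝ)⁻¹ * ∑ c ∈ hfin.toFinset, φ c := by
  classical
  set S := hfin.toFinset with hS
  have hmem : ∀ c, c ∈ S ↔ ∃ τ : Γ, τ • b = c := fun c => by
    rw [hS, Set.Finite.mem_toFinset]; rfl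
  set m : ℝ := (haarProb Γ).real {τ : Γ | τ • b = b} with hm
  -- Left translation by σ pulls the fibre over σ • b back to the stabilizer of `b`.
  have hconst : ∀ c ∈ S, (haarProb Γ).real {τ : Γ | τ • b = c} = m := by
    intro c hc
    obtain ⟨σ, rfl⟩ := (hmem c).1 hc
    rw [hm, measureReal_def, measureReal_def, ← measure_preimage_mul (haarProb Γ) σ]
    congr 3
    ext τ
    simp [mul_smul]
  have hsum : ∀ ψ : Ω → ℝ, ∫ τ : Γ, ψ (τ • b) ∂haarProb Γ = m * ∑ c ∈ S, ψ c := by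
    intro ψ
    have h1 : ∀ τ : Γ, ψ (τ • b) =
        ∑ c ∈ S, ({τ : Γ | τ • b = c}).indicator (fun _ => ψ c) τ := by
      intro τ
      rw [Finset.sum_eq_single (τ • b)]
      · simp
      · intro c _ hc
        exact Set.indicator_of_notMem (fun h => hc (Eq.symm h)) _
      · exact fun h => absurd ((hmem _).2 ⟨τ, rfl⟩) h
    simp_rw [h1]
    rw [integral_finsetSum _ fun c _ => (integrable_const _).indicator (hmeas c), Finset.mul_sum]
    refine Finset.sum_congr rfl fun c hc => ?_
    rw [integral_indicator_const _ (hmeas c), hconst c hc, smul_eq_mul]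
  -- The total mass, i.e. the constant function 1, determines the common mass `m` of the fibres.
  have h1 : m * S.card = 1 := by
    have := hsum fun _ => 1
    simpa using this.symm
  rw [hsum, eq_inv_of_mul_eq_one_left h1]

/-! ### The Galois action modulo torsion -/

theorem isOpen_setOf_smul_eq (a b : QBarˣ) : IsOpen {g : GalQ | g • a = b} := by
  rw [isOpen_iff_mem_nhds]
  intro g hg
  refine Filter.mem_of_superset (((stabilizer_isOpen_of_isIntegral (K := ℚ) (a : QBar)).leftCoset
    g).mem_nhds ⟨1, one_mem _, mul_one g⟩) ?_
  rintro _ ⟨s, hs, rfl⟩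
  have hs' : s • a = a := Units.ext hs
  change (g * s) • a = b
  rw [mul_smul, hs', hg]

/-- Serves for orbits in `G`, where an equation modulo torsion only confines g • a to a coset `T` of
the torsion group. -/
theorem isOpen_setOf_smul_mem (a : QBarˣ) (T : Set QBarˣ) : IsOpen {g : GalQ | g • a ∈ T} := by
  have : {g : GalQ | g • a ∈ T} = ⋃ b ∈ T, {g : GalQ | g • a = b} := by
    ext g; simp
  rw [this]
  exact isOpen_biUnion fun b _ => isOpen_setOf_smul_eq a b

/-- The action of the absolute Galois group on `QBarˣ` modulo torsion. -/
noncomputable instance : MulAction GalQ G where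
  smul τ := galG τ
  one_smul α := by
    obtain ⟨a, rfl⟩ := QuotientGroup.mk_surjective α
    exact congrArg _ (one_smul GalQ a)
  mul_smul σ τ α := by
    obtain ⟨a, rfl⟩ := QuotientGroup.mk_surjective α
    exact congrArg _ (mul_smul σ τ a)

theorem smul_mk (τ : GalQ) (a : QBarˣ) : τ • (a : G) = ((τ • a : QBarˣ) : G) := rfl

theorem logAbs_of_mem_torsion {a : QBarˣ} (ha : a ∈ CommGroup.torsion QBarˣ) : logAbs a = 0 := by
  obtain ⟨n, hn, h⟩ := isOfFinOrder_iff_pow_eq_one.1 ((CommGroup.mem_torsion _).1 ha)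
  funext y
  have h1 : y.abv (a : QBar) ^ n = 1 := by
    rw [← map_pow, ← Units.val_pow_eq_pow_val, h, Units.val_one, map_one]
  change Real.log _ = 0
  rw [(pow_eq_one_iff_of_nonneg (y.abv.nonneg _) hn.ne').1 h1, Real.log_one]

/-- The function `y ↦ log ‖α‖_y` for `α` in `QBarˣ` modulo torsion. -/
noncomputable def logG (α : G) : Place → ℝ := logAbs (Quotient.out α)

theorem logG_mk (a : QBarˣ) : logG (a : G) = logAbs a := by
  have h : (Quotient.out (a : G))⁻¹ * a ∈ CommGroup.torsion QBarˣ :=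
    QuotientGroup.eq.1 (Quotient.out_eq (a : G))
  have := logAbs_mul (Quotient.out (a : G)) ((Quotient.out (a : G))⁻¹ * a)
  rw [logAbs_of_mem_torsion h, add_zero, mul_inv_cancel_left] at this
  exact this.symm

theorem coe_fVec_ae (α : G) : ((fVec α : XSpace) : Lp ℝ 1 weilMeasure) =ᵐ[weilMeasure] logG α := by
  obtain ⟨a, rfl⟩ := QuotientGroup.mk_surjective α
  rw [logG_mk]
  exact (integrable_logAbs a).coeFn_toL1

theorem logG_smul (τ : GalQ) (α : G) (y : Place) : logG α (τ⁻¹ • y) = logG (τ • α) y := by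
  obtain ⟨a, rfl⟩ := QuotientGroup.mk_surjective α
  rw [smul_mk, logG_mk, logG_mk, logAbs_smul]

theorem XSpace_ext {F H : XSpace}
    (h : (F : Lp ℝ 1 weilMeasure) =ᵐ[weilMeasure] (H : Lp ℝ 1 weilMeasure)) : F = H :=
  Subtype.ext (Lp.ext h)

/-! ### The operator `U_K` on the functions `f_α` -/

section
variable (K : IntermediateField ℚ QBar)

theorem UOp_ae (F : XSpace) :
    ((UOp K F : XSpace) : Lp ℝ 1 weilMeasure) =ᵐ[weilMeasure] average K F.1 :=
  Integrable.coeFn_toL1 (integrable_average K (L1.integrable_coeFn F.1))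

theorem coe_finsetSum_ae {ι : Type*} (S : Finset ι) (f : ι → XSpace) :
    ((∑ i ∈ S, f i : XSpace) : Lp ℝ 1 weilMeasure) =ᵐ[weilMeasure]
      fun y => ∑ i ∈ S, (f i : Lp ℝ 1 weilMeasure) y := by
  classical
  induction S using Finset.induction_on with
  | empty =>
    simp only [Finset.sum_empty]
    exact Lp.coeFn_zero ℝ 1 weilMeasure
  | insert i S hi ih =>
    simp only [Finset.sum_insert hi]
    filter_upwards [Lp.coeFn_add (f i : Lp ℝ 1 weilMeasure) (∑ i ∈ S, f i : XSpace), ih]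
      with y h1 h2
    rw [← h2]
    exact h1

/-- The operator `U_K` averages `f_α` over a finite set of conjugates of `α` whenever the
corresponding averages of the functions `log ‖α‖_y` agree. -/
theorem UOp_fVec_eq {ι : Type*} (S : Finset ι) (c : ι → G) (α : G)
    (h : ∀ y, ∫ τ : K.fixingSubgroup, logG ((τ : GalQ) • α) y ∂nuK K =
      (S.card : ℝ)⁻¹ * ∑ i ∈ S, logG (c i) y) :
    UOp K (fVec α) = (S.card : ℝ)⁻¹ • ∑ i ∈ S, fVec (c i) := by
  refine XSpace_ext ?_
  have h0 : ∀ᵐ y ∂weilMeasure, ∀ i ∈ S, ((fVec (c i) : XSpace) : Lp ℝ 1 weilMeasure) y =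
      logG (c i) y :=
    (Finset.eventually_all S).2 fun i _ => coe_fVec_ae (c i)
  filter_upwards [UOp_ae K (fVec α), average_congr K (coe_fVec_ae α), h0,
    coe_finsetSum_ae S fun i => fVec (c i),
    Lp.coeFn_smul (S.card : ℝ)⁻¹ ((∑ i ∈ S, fVec (c i) : XSpace) : Lp ℝ 1 weilMeasure)]
    with y h1 h2 h3 h4 h5
  rw [h1, h2]
  refine Eq.trans ?_ h5.symm
  rw [Pi.smul_apply, h4, Finset.sum_congr rfl h3, smul_eq_mul, ← h y]
  refine integral_congr_ae (Filter.Eventually.of_forall fun τ => ?_)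
  exact logG_smul (τ : GalQ) α y

theorem finite_subgroup_orbit (a : QBarˣ) : (MulAction.orbit K.fixingSubgroup a).Finite :=
  (finite_orbit a).subset (by rintro _ ⟨τ, rfl⟩; exact ⟨(τ : GalQ), rfl⟩)

/-- The Galois correspondence for the infinite extension QBar/ℚ, which allows `K` of infinite
degree. -/
theorem mem_of_fixed (x : QBar) (h : ∀ τ : K.fixingSubgroup, (τ : GalQ) x = x) : x ∈ K := by
  rw [← InfiniteGalois.fixedField_fixingSubgroup K]
  exact h

/-- The orbit is taken in `QBarˣ` and not in `G`: the product of the conjugates must be invariant on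
the nose, not merely modulo torsion, to lie in `K`. -/
theorem UOp_fVec_mem (α : G) : UOp K (fVec α) ∈ DSpace K := by
  classical
  obtain ⟨a, rfl⟩ := QuotientGroup.mk_surjective α
  have hfin := finite_subgroup_orbit K a
  have key : ∀ y, ∫ τ : K.fixingSubgroup, logG ((τ : GalQ) • (a : G)) y ∂nuK K =
      (hfin.toFinset.card : ℝ)⁻¹ * ∑ b ∈ hfin.toFinset, logG (b : G) y := by
    intro y
    refine Eq.trans ?_ (integral_orbit_eq_average a hfin (fun c => ?_) fun b => logG (b : G) y)
    · rfl
    · exact ((isOpen_setOf_smul_eq a c).preimage continuous_subtype_val).measurableSet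
  have h1 := UOp_fVec_eq K hfin.toFinset (fun b => (b : G)) (a : G) key
  have h2 : ∑ b ∈ hfin.toFinset, fVec (b : G) = fVec ((∏ b ∈ hfin.toFinset, b : QBarˣ) : G) := by
    induction hfin.toFinset using Finset.induction_on with
    | empty => simpa using fVec_one.symm
    | insert b S hb ih => rw [Finset.sum_insert hb, Finset.prod_insert hb, ih, ← fVec_mul]; rfl
  have h3 : ((∏ b ∈ hfin.toFinset, b : QBarˣ) : QBar) ∈ K := by
    refine mem_of_fixed K _ fun τ => ?_
    refine congrArg Units.val (a₁ := τ • (∏ b ∈ hfin.toFinset, b)) ?_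
    rw [Finset.smul_prod']
    refine Finset.prod_bij (fun b _ => τ • b) ?_ ?_ ?_ ?_
    · intro b hb
      rw [Set.Finite.mem_toFinset] at hb ⊢
      exact MulAction.mem_orbit_of_mem_orbit τ hb
    · intro b _ c _ h
      exact smul_left_cancel τ h
    · intro b hb
      rw [Set.Finite.mem_toFinset] at hb
      exact ⟨τ⁻¹ • b, by
        rw [Set.Finite.mem_toFinset]; exact MulAction.mem_orbit_of_mem_orbit τ⁻¹ hb, by simp⟩
    · intro b _; rfl
  change UOp K (fVec (a : G)) ∈ _
  rw [h1, h2]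
  have h4 : fVec ((∏ b ∈ hfin.toFinset, b : QBarˣ) : G) ∈ DSpace K :=
    Submodule.subset_span ⟨_, ⟨_, h3, rfl⟩, rfl⟩
  have h5 := (DSpace K).smul_mem ((hfin.toFinset.card : ℚ)⁻¹) h4
  rw [← Rat.cast_smul_eq_qsmul ℝ] at h5
  simpa using h5

theorem UOp_of_mem_DSpace {F : XSpace} (hF : F ∈ DSpace K) : UOp K F = F := by
  have h : DSpace K ≤ LinearMap.eqLocus ((UOp K).toLinearMap.restrictScalars ℚ) LinearMap.id := by
    refine Submodule.span_le.2 ?_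
    rintro _ ⟨_, ⟨a, ha, rfl⟩, rfl⟩
    -- A generator is fixed by Aut(QBar/K), so the averaging formula applies with a one-point index
    -- set.
    have := UOp_fVec_eq K (Finset.univ : Finset Unit) (fun _ => (a : G)) (a : G) (by
      intro y
      have : ∀ τ : K.fixingSubgroup, (τ : GalQ) • (a : G) = a := by
        intro τ
        rw [smul_mk]
        exact congrArg _ (Units.ext ((IntermediateField.mem_fixingSubgroup_iff K _).1 τ.2 _ ha))
      simp [this])
    simpa using this
  exact h hF

theorem DSpace_le : DSpace K ≤ FSpace := by
  refine Submodule.span_le.2 ?_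
  rintro _ ⟨α, _, rfl⟩
  exact fVec_mem α

theorem orbit_eq (β : G) : orbit K β = MulAction.orbit K.fixingSubgroup β := by
  ext γ
  constructor
  · rintro ⟨τ, hτ, rfl⟩
    exact ⟨⟨τ, hτ⟩, rfl⟩
  · rintro ⟨τ, rfl⟩
    exact ⟨τ, τ.2, rfl⟩

theorem finite_orbit_G (β : G) : (orbit K β).Finite := by
  obtain ⟨b, rfl⟩ := QuotientGroup.mk_surjective β
  refine ((finite_subgroup_orbit K b).image ((↑) : QBarˣ → G)).subset ?_
  rintro _ ⟨τ, hτ, rfl⟩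
  exact ⟨τ • b, ⟨⟨τ, hτ⟩, rfl⟩, rfl⟩

theorem UOp_fVec (β : G) :
    UOp K (fVec β) = ((orbit K β).ncard : ℚ)⁻¹ • ∑ᶠ γ ∈ orbit K β, fVec γ := by
  have hfin := finite_orbit_G K β
  rw [finsum_mem_eq_finite_toFinset_sum _ hfin, Set.ncard_eq_toFinset_card _ hfin,
    ← Rat.cast_smul_eq_qsmul ℝ]
  have hfin' := hfin
  rw [orbit_eq] at hfin'
  have e : hfin.toFinset = hfin'.toFinset := by ext; simp [orbit_eq]
  have key : ∀ y, ∫ τ : K.fixingSubgroup, logG ((τ : GalQ) • β) y ∂nuK K =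
      (hfin.toFinset.card : ℝ)⁻¹ * ∑ γ ∈ hfin.toFinset, logG γ y := by
    intro y
    rw [e]
    refine Eq.trans ?_ (integral_orbit_eq_average β hfin' (fun c => ?_) fun γ => logG γ y)
    · rfl
    · obtain ⟨b, rfl⟩ := QuotientGroup.mk_surjective β
      exact ((isOpen_setOf_smul_mem b {d | (d : G) = c}).preimage
        continuous_subtype_val).measurableSet
  have := UOp_fVec_eq K hfin.toFinset id β key
  simpa using this

end

/-! ### Formal consequences of the density of the functions `f_α` -/

/-- Density enters only in two inclusions: the range of `U_K` is contained in the closure of `D_K`,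
and its kernel in the closure of `E_K`. -/
theorem main_of_dense (hdense : closure (FSpace : Set XSpace) = Set.univ)
    (K : IntermediateField ℚ QBar) :
    Continuous (SOp K) ∧
    DSpace K ≤ FSpace ∧
    LinearMap.range (SOp K) = DSpace K ∧
    (∀ F : FSpace, (F : XSpace) ∈ DSpace K → SOp K F = F) ∧
    Disjoint (DSpace K) (ESpace K) ∧
    DSpace K ⊔ ESpace K = FSpace ∧
    closure (DSpace K : Set XSpace) = LinearMap.range (UOp K).toLinearMap ∧
    closure (ESpace K : Set XSpace) = LinearMap.ker (UOp K).toLinearMap ∧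
    IsFClosed (DSpace K : Set XSpace) ∧
    IsFClosed (ESpace K : Set XSpace) ∧
    (∀ β : G, (orbit K β).Finite ∧
      SOp K ⟨fVec β, fVec_mem β⟩ =
        ((orbit K β).ncard : ℚ)⁻¹ • ∑ᶠ γ ∈ orbit K β, fVec γ) := by
  have hU : ∀ F ∈ FSpace, UOp K F ∈ DSpace K := by
    rintro _ ⟨α, rfl⟩
    exact UOp_fVec_mem K α
  have hid : ∀ F ∈ DSpace K, UOp K F = F := fun F hF => UOp_of_mem_DSpace K hF
  have hDF := DSpace_le K
  have hE : ∀ F, F ∈ ESpace K ↔ F ∈ FSpace ∧ UOp K F = 0 := by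
    intro F
    constructor
    · rintro ⟨x, hx, rfl⟩
      exact ⟨x.2, hx⟩
    · rintro ⟨h1, h2⟩
      exact ⟨⟨F, h1⟩, h2, rfl⟩
  have hsub : ∀ F ∈ FSpace, F - UOp K F ∈ ESpace K := by
    intro F hF
    refine (hE _).2 ⟨FSpace.sub_mem hF (hDF (hU F hF)), ?_⟩
    rw [map_sub, hid _ (hU F hF), sub_self]
  have hcl : ∀ F ∈ closure (DSpace K : Set XSpace), UOp K F = F := by
    have : IsClosed {F : XSpace | UOp K F = F} := isClosed_eq (UOp K).continuous continuous_id
    exact fun F hF => closure_minimal hid this hF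
  have hclE : ∀ F ∈ closure (ESpace K : Set XSpace), UOp K F = 0 := by
    have : IsClosed {F : XSpace | UOp K F = 0} := isClosed_eq (UOp K).continuous continuous_const
    exact fun F hF => closure_minimal (fun F hF => ((hE F).1 hF).2) this hF
  refine ⟨(UOp K).continuous.comp continuous_subtype_val, hDF, ?_, fun F hF => hid _ hF, ?_, ?_,
    ?_, ?_, ?_, ?_, fun β => ⟨finite_orbit_G K β, UOp_fVec K β⟩⟩
  · refine le_antisymm ?_ fun F hF => ⟨⟨F, hDF hF⟩, hid F hF⟩
    rintro _ ⟨F, rfl⟩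
    exact hU F F.2
  · rw [Submodule.disjoint_def]
    intro F h1 h2
    rw [← hid F h1, ((hE F).1 h2).2]
  · refine le_antisymm (sup_le hDF fun F hF => ((hE F).1 hF).1) fun F hF => ?_
    rw [← add_sub_cancel (UOp K F) F]
    exact Submodule.add_mem_sup (hU F hF) (hsub F hF)
  · refine Set.Subset.antisymm (fun F hF => ⟨F, hcl F hF⟩) ?_
    rintro _ ⟨F, rfl⟩
    have hF : F ∈ closure (FSpace : Set XSpace) := hdense ▸ Set.mem_univ F
    exact map_mem_closure (UOp K).continuous hF hU
  · refine Set.Subset.antisymm hclE fun F hF => ?_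
    have hF' : F ∈ closure (FSpace : Set XSpace) := hdense ▸ Set.mem_univ F
    -- The map 1 - `U_K` sends F into `E_K` and fixes the kernel of `U_K`.
    have := map_mem_closure (f := fun F => F - UOp K F)
      (continuous_id.sub (UOp K).continuous) hF' hsub
    have h0 : UOp K F = 0 := hF
    simpa [h0] using this
  · refine Set.Subset.antisymm (fun F hF => ⟨hDF hF, subset_closure hF⟩) ?_
    rintro F ⟨h1, h2⟩
    have := hU F h1
    rwa [hcl F h2] at this
  · refine Set.Subset.antisymm (fun F hF => ⟨((hE F).1 hF).1, subset_closure hF⟩) ?_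
    rintro F ⟨h1, h2⟩
    exact (hE F).2 ⟨h1, hclE F h2⟩

/-! ### The topology and the measure on the space of places -/

/-- Agreeing on `k` is an equivalence relation, so two sets Y(k, ·) are equal or disjoint. -/
theorem Place.over_eq_of_mem {k : IntermediateField ℚ QBar} {y z : Place}
    (h : y ∈ Place.over k z) : Place.over k y = Place.over k z := by
  ext w
  exact ⟨fun hw a ha => (hw a ha).trans (h a ha), fun hw a ha => (hw a ha).trans (h a ha).symm⟩

theorem Place.self_mem_over (k : IntermediateField ℚ QBar) (z : Place) : z ∈ Place.over k z :=
  fun _ _ => rfl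

theorem Place.over_anti {k l : IntermediateField ℚ QBar} (h : k ≤ l) (z : Place) :
    Place.over l z ⊆ Place.over k z :=
  fun _ hw a ha => hw a (h ha)

theorem Place.mem_over_iff_of_mem {k l : IntermediateField ℚ QBar} (h : k ≤ l) {w y z : Place}
    (hw : w ∈ Place.over l y) : w ∈ Place.over k z ↔ y ∈ Place.over k z := by
  have hw' := Place.over_anti h y hw
  constructor
  · intro h1
    rw [← Place.over_eq_of_mem h1, Place.over_eq_of_mem hw']
    exact Place.self_mem_over _ _
  · intro h1
    rwa [← Place.over_eq_of_mem h1]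

theorem finiteDimensional_adjoin (a : QBar) :
    FiniteDimensional ℚ (IntermediateField.adjoin ℚ {a}) :=
  IntermediateField.adjoin.finiteDimensional (Algebra.IsIntegral.isIntegral _)

/-- An element on which two places differ separates them already over the number field it generates.
The Hausdorff property makes the compact Galois orbits closed. -/
instance : T2Space Place where
  t2 y z hyz := by
    have : ∃ a, y.abv a ≠ z.abv a := by
      by_contra! h
      exact hyz (Place.ext (AbsoluteValue.ext h))
    obtain ⟨a, ha⟩ := this
    have := finiteDimensional_adjoin a
    refine ⟨_, _, Place.isOpen_over (IntermediateField.adjoin ℚ {a}) y,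
      Place.isOpen_over (IntermediateField.adjoin ℚ {a}) z, Place.self_mem_over _ _,
      Place.self_mem_over _ _, Set.disjoint_left.2 fun w h1 h2 => ha ?_⟩
    have ha' := IntermediateField.mem_adjoin_simple_self ℚ a
    rw [← h1 a ha', h2 a ha']

/-- Each summand of the measure is carried by one Galois orbit. Working almost everywhere on these
orbits avoids any appeal to transitivity of the Galois action on the places over `u`. -/
theorem ae_weilMeasure {p : Place → Prop} (h : ∀ u (g : GalQ), p (g • basePlace u)) :
    ∀ᵐ y ∂weilMeasure, p y := by
  unfold weilMeasure
  rw [Measure.ae_sum_iff]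
  intro u
  have hc : Continuous fun g : GalQ => g • basePlace u := continuous_id.smul continuous_const
  have hm : MeasurableSet (Set.range fun g : GalQ => g • basePlace u) :=
    (isCompact_range hc).isClosed.measurableSet
  have h0 : ∀ᵐ y ∂((haarProb GalQ).map fun g => g • basePlace u),
      y ∈ Set.range fun g : GalQ => g • basePlace u := by
    refine (ae_map_iff hc.measurable.aemeasurable hm).2 ?_
    exact Filter.Eventually.of_forall fun g => ⟨g, rfl⟩
  filter_upwards [h0] with y hy
  obtain ⟨g, rfl⟩ := hy
  exact h u g

/-- The set of places over a place of `ℚ`. -/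
def placesOver (u : Option Nat.Primes) : Set Place := Place.over ⊥ (basePlace u)

theorem isOpen_placesOver (u : Option Nat.Primes) : IsOpen (placesOver u) :=
  Place.isOpen_over ⊥ _

theorem measurableSet_placesOver (u : Option Nat.Primes) : MeasurableSet (placesOver u) :=
  (isOpen_placesOver u).measurableSet

theorem smul_basePlace_mem (g : GalQ) (u : Option Nat.Primes) : g • basePlace u ∈ placesOver u := by
  intro a ha
  obtain ⟨q, rfl⟩ := IntermediateField.mem_bot.1 ha
  rw [Place.smul_abv, AlgEquiv.commutes]

theorem basePlace_injective {u v : Option Nat.Primes}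
    (h : ∀ q : ℚ, (basePlace u).abv (algebraMap ℚ QBar q) =
      (basePlace v).abv (algebraMap ℚ QBar q)) : u = v := by
  have harch : ∀ p : Nat.Primes, ¬ ∀ q : ℚ, |(q : ℝ)| = (padicNorm (p : ℕ) q : ℝ) := by
    intro p h
    have : Fact (p : ℕ).Prime := ⟨p.2⟩
    -- The integer 2 has usual absolute value 2, but p-adic absolute value at most 1.
    have h1 := h ((2 : ℤ) : ℚ)
    have h2 := padicNorm.of_int (p := p) 2
    have h3 : ((padicNorm (p : ℕ) ((2 : ℤ) : ℚ) : ℚ) : ℝ) ≤ 1 := by exact_mod_cast h2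
    rw [← h1] at h3
    norm_num at h3
  cases u with
  | none =>
    cases v with
    | none => rfl
    | some p =>
      simp only [basePlace, archPlace_rat, padicPlace_rat] at h
      exact absurd h (harch p)
  | some p =>
    cases v with
    | none =>
      simp only [basePlace, archPlace_rat, padicPlace_rat] at h
      exact absurd (fun q => (h q).symm) (harch p)
    | some r =>
      have : Fact (p : ℕ).Prime := ⟨p.2⟩
      have : Fact (r : ℕ).Prime := ⟨r.2⟩
      by_contra hne
      have hne' : (r : ℕ) ≠ p := fun h => hne (congrArg some (Subtype.ext h.symm))
      have h1 := h (p : ℕ)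
      simp only [basePlace, padicPlace_rat] at h1
      rw [padicNorm.padicNorm_of_prime_of_ne hne',
        show padicNorm (p : ℕ) ((p : ℕ) : ℚ) = ((p : ℕ) : ℚ)⁻¹ from
          padicNorm.padicNorm_p_of_prime] at h1
      have h2 : ((p : ℕ) : ℝ) = 1 := by simpa using h1
      exact p.2.one_lt.ne' (by exact_mod_cast h2)

theorem eq_of_mem_placesOver {y : Place} {u v : Option Nat.Primes} (hu : y ∈ placesOver u)
    (hv : y ∈ placesOver v) : u = v :=
  basePlace_injective fun q =>
    have hq : algebraMap ℚ QBar q ∈ (⊥ : IntermediateField ℚ QBar) :=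
      IntermediateField.mem_bot.2 ⟨q, rfl⟩
    (hu _ hq).symm.trans (hv _ hq)

theorem weilMeasure_placesOver (u : Option Nat.Primes) : weilMeasure (placesOver u) = 1 := by
  unfold weilMeasure
  rw [Measure.sum_apply _ (measurableSet_placesOver u), tsum_eq_single u]
  · rw [Measure.map_apply (measurable_orbit _) (measurableSet_placesOver u)]
    have : (fun g : GalQ => g • basePlace u) ⁻¹' placesOver u = Set.univ :=
      Set.eq_univ_of_forall fun g => smul_basePlace_mem g u
    rw [this, measure_univ]
  · intro v hv
    rw [Measure.map_apply (measurable_orbit _) (measurableSet_placesOver u)]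
    have : (fun g : GalQ => g • basePlace v) ⁻¹' placesOver u = ∅ :=
      Set.eq_empty_of_forall_notMem fun g hg =>
        hv (eq_of_mem_placesOver (smul_basePlace_mem g v) hg)
    rw [this, measure_empty]

theorem measure_ne_top_of_subset_placesOver {s : Set Place} {u : Option Nat.Primes}
    (h : s ⊆ placesOver u) : weilMeasure s ≠ ⊤ :=
  ((measure_mono h).trans_lt (by rw [weilMeasure_placesOver]; exact ENNReal.one_lt_top)).ne

/-! ### Functions whose class in `L¹` lies in a closed subspace -/

section
variable (M : Submodule ℝ (Lp ℝ 1 weilMeasure))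

/-- The function `h` is integrable and its class in `L¹` lies in the subspace `M`. -/
def ClassMem (h : Place → ℝ) : Prop :=
  ∃ hi : Integrable h weilMeasure, hi.toL1 h ∈ M

variable {M}

theorem ClassMem.congr {h h' : Place → ℝ} (hh : ClassMem M h) (e : h =ᵐ[weilMeasure] h') :
    ClassMem M h' := by
  obtain ⟨hi, hm⟩ := hh
  exact ⟨hi.congr e, by rwa [← (Integrable.toL1_eq_toL1_iff _ _ hi (hi.congr e)).2 e]⟩

theorem ClassMem.add {h h' : Place → ℝ} (hh : ClassMem M h) (hh' : ClassMem M h') :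
    ClassMem M (h + h') := by
  obtain ⟨hi, hm⟩ := hh
  obtain ⟨hi', hm'⟩ := hh'
  exact ⟨hi.add hi', by rw [Integrable.toL1_add _ _ hi hi']; exact M.add_mem hm hm'⟩

theorem ClassMem.smul {h : Place → ℝ} (c : ℝ) (hh : ClassMem M h) : ClassMem M (c • h) := by
  obtain ⟨hi, hm⟩ := hh
  exact ⟨hi.smul c, (Integrable.toL1_smul h hi c).symm ▸ M.smul_mem c hm⟩

theorem ClassMem.sub {h h' : Place → ℝ} (hh : ClassMem M h) (hh' : ClassMem M h') :
    ClassMem M (h - h') := by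
  have := hh.add (hh'.smul (-1))
  rwa [neg_one_smul, ← sub_eq_add_neg] at this

theorem ClassMem.zero : ClassMem M 0 :=
  ⟨integrable_zero _ _ _, by rw [Integrable.toL1_zero]; exact M.zero_mem⟩

theorem ClassMem.sum {ι : Type*} (S : Finset ι) {h : ι → Place → ℝ}
    (hh : ∀ i ∈ S, ClassMem M (h i)) : ClassMem M (∑ i ∈ S, h i) := by
  classical
  induction S using Finset.induction_on with
  | empty => simpa using ClassMem.zero
  | insert i S hi ih =>
    rw [Finset.sum_insert hi]
    exact (hh i (Finset.mem_insert_self i S)).add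
      (ih fun j hj => hh j (Finset.mem_insert_of_mem hj))

theorem classMem_indicator_iff {s : Set Place} (hs : MeasurableSet s) (hμ : weilMeasure s ≠ ⊤) :
    ClassMem M (s.indicator fun _ => (1 : ℝ)) ↔ indicatorConstLp 1 hs hμ (1 : ℝ) ∈ M :=
  ⟨fun ⟨_, hm⟩ => hm,
    fun hm => ⟨memLp_one_iff_integrable.1 (memLp_indicator_const 1 hs 1 (Or.inr hμ)), hm⟩⟩

/-- Because the union has finite measure, the finite subunions converge to it in measure, so their
indicators converge in L¹ and closedness of `M` applies. -/
theorem classMem_iUnion (hM : IsClosed (M : Set (Lp ℝ 1 weilMeasure))) {ι : Type*} [Countable ι]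
    {s : ι → Set Place} (hs : ∀ i, MeasurableSet (s i)) (hd : Pairwise (Function.onFun Disjoint s))
    (hμ : weilMeasure (⋃ i, s i) ≠ ⊤)
    (hm : ∀ i, ClassMem M ((s i).indicator fun _ => (1 : ℝ))) :
    ClassMem M ((⋃ i, s i).indicator fun _ => (1 : ℝ)) := by
  classical
  rw [classMem_indicator_iff (MeasurableSet.iUnion hs) hμ]
  have hsub : ∀ F : Finset ι, (⋃ i ∈ F, s i) ⊆ ⋃ i, s i := fun F =>
    Set.iUnion₂_subset fun i _ => Set.subset_iUnion s i
  have hF : ∀ F : Finset ι, MeasurableSet (⋃ i ∈ F, s i) := fun F =>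
    F.measurableSet_biUnion fun i _ => hs i
  have hFμ : ∀ F : Finset ι, weilMeasure (⋃ i ∈ F, s i) ≠ ⊤ := fun F =>
    measure_ne_top_of_subset (hsub F) hμ
  have htend : Filter.Tendsto
      (fun F : Finset ι => weilMeasure (symmDiff (⋃ i ∈ F, s i) (⋃ i, s i)))
      Filter.atTop (𝓝 0) := by
    have h1 : ∀ F : Finset ι, weilMeasure (symmDiff (⋃ i ∈ F, s i) (⋃ i, s i)) =
        weilMeasure (⋃ i, s i) - ∑ i ∈ F, weilMeasure (s i) := by
      intro F
      rw [← measure_biUnion_finset (fun i _ j _ h => hd h) (fun i _ => hs i),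
        ← measure_sdiff (hsub F) (hF F).nullMeasurableSet (hFμ F), Set.symmDiff_def,
        Set.sdiff_eq_empty.2 (hsub F), Set.empty_union]
    simp_rw [h1]
    rw [← tsub_self (weilMeasure (⋃ i, s i))]
    refine ENNReal.Tendsto.sub tendsto_const_nhds ?_ (Or.inl hμ)
    rw [measure_iUnion hd hs]
    exact ENNReal.summable.hasSum
  refine hM.mem_of_tendsto (tendsto_indicatorConstLp_set (ht := hF) (hμt := hFμ)
    ENNReal.one_ne_top htend) (Filter.Eventually.of_forall fun F => ?_)
  rw [SetLike.mem_coe, ← classMem_indicator_iff]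
  convert ClassMem.sum F (h := fun i => (s i).indicator fun _ => (1 : ℝ)) fun i _ => hm i using 1
  ext y
  rw [Finset.indicator_biUnion_apply F s (fun i _ j _ h => hd h), Finset.sum_apply]

/-! ### Sets of places that are determined by a number field -/

/-- The set `s` is a union of sets `Y(k, v)`. -/
def IsSaturated (k : IntermediateField ℚ QBar) (s : Set Place) : Prop :=
  ∀ y ∈ s, Place.over k y ⊆ s

theorem IsSaturated.isOpen {k : IntermediateField ℚ QBar} [FiniteDimensional ℚ k] {s : Set Place}
    (hs : IsSaturated k s) : IsOpen s :=
  isOpen_iff_mem_nhds.2 fun y hy =>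
    Filter.mem_of_superset ((Place.isOpen_over k y).mem_nhds (Place.self_mem_over k y)) (hs y hy)

/-- The set over g • z depends only on the embedding of `k` obtained by restricting g⁻¹, and `k` has
finitely many embeddings in `QBar`. -/
theorem finite_setOf_over (k : IntermediateField ℚ QBar) [FiniteDimensional ℚ k] (z : Place) :
    (Set.range fun g : GalQ => Place.over k (g • z)).Finite := by
  have h : ∀ g g' : GalQ, ((g⁻¹ : GalQ).toAlgHom.comp k.val = (g'⁻¹ : GalQ).toAlgHom.comp k.val) →
      Place.over k (g • z) = Place.over k (g' • z) := by
    intro g g' h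
    refine Place.over_eq_of_mem fun a ha => ?_
    rw [Place.smul_abv, Place.smul_abv]
    exact congrArg z.abv (DFunLike.congr_fun h ⟨a, ha⟩)
  have hfin : Finite (k →ₐ[ℚ] QBar) := inferInstance
  let r : GalQ → (k →ₐ[ℚ] QBar) := fun g => (g⁻¹ : GalQ).toAlgHom.comp k.val
  refine Set.Finite.subset (Set.finite_range fun ρ : Set.range r =>
    Place.over k (ρ.2.choose • z)) ?_
  rintro _ ⟨g, rfl⟩
  exact ⟨⟨r g, g, rfl⟩, h _ _ (⟨g, rfl⟩ : r g ∈ Set.range r).choose_spec⟩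

theorem over_subset_placesOver (k : IntermediateField ℚ QBar) (g : GalQ) (u : Option Nat.Primes) :
    Place.over k (g • basePlace u) ⊆ placesOver u := by
  refine (Place.over_anti bot_le _).trans ?_
  rw [Place.over_eq_of_mem (smul_basePlace_mem g u)]
  exact subset_rfl

/-- Up to a null set, the part of `s` over `u` is a finite disjoint union of sets Y(k, v) with
centres in the orbit of the base place. -/
theorem classMem_indicator_saturated {k : IntermediateField ℚ QBar} [FiniteDimensional ℚ k]
    (hballs : ∀ u (g : GalQ), ClassMem M ((Place.over k (g • basePlace u)).indicator fun _ => 1))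
    {s : Set Place} (hs : IsSaturated k s) (u : Option Nat.Primes) :
    ClassMem M ((s ∩ placesOver u).indicator fun _ => 1) := by
  classical
  have hfin : {b : Set Place | ∃ g : GalQ, g • basePlace u ∈ s ∧
      b = Place.over k (g • basePlace u)}.Finite :=
    (finite_setOf_over k (basePlace u)).subset (by rintro _ ⟨g, _, rfl⟩; exact ⟨g, rfl⟩)
  have h1 : ClassMem M (∑ b ∈ hfin.toFinset, b.indicator fun _ => (1 : ℝ)) := by
    refine ClassMem.sum _ fun b hb => ?_
    obtain ⟨g, _, rfl⟩ := hfin.mem_toFinset.1 hb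
    exact hballs u g
  refine h1.congr (ae_weilMeasure fun v g => ?_)
  rw [Finset.sum_apply]
  by_cases hy : g • basePlace v ∈ s ∩ placesOver u
  · have huv := eq_of_mem_placesOver (smul_basePlace_mem g v) hy.2
    subst huv
    rw [Set.indicator_of_mem hy, Finset.sum_eq_single (Place.over k (g • basePlace v))]
    · rw [Set.indicator_of_mem (Place.self_mem_over k _)]
    · intro b hb hne
      obtain ⟨g', _, rfl⟩ := hfin.mem_toFinset.1 hb
      exact Set.indicator_of_notMem (fun h => hne (Place.over_eq_of_mem h).symm) _
    · exact fun h => absurd (hfin.mem_toFinset.2 ⟨g, hy.1, rfl⟩) h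
  · rw [Set.indicator_of_notMem hy]
    refine Finset.sum_eq_zero fun b hb => Set.indicator_of_notMem (fun h => hy ?_) _
    obtain ⟨g', hg', rfl⟩ := hfin.mem_toFinset.1 hb
    exact ⟨hs _ hg' h, over_subset_placesOver k g' u h⟩

/-- The sets of places that are determined by some number field. -/
def saturatedSets : Set (Set Place) :=
  {s | ∃ k : IntermediateField ℚ QBar, FiniteDimensional ℚ k ∧ IsSaturated k s}

theorem IsSaturated.mono {k l : IntermediateField ℚ QBar} (h : k ≤ l) {s : Set Place}
    (hs : IsSaturated k s) : IsSaturated l s :=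
  fun y hy => (Place.over_anti h y).trans (hs y hy)

theorem isPiSystem_saturatedSets : IsPiSystem saturatedSets := by
  rintro s ⟨k, hk, hs⟩ t ⟨l, hl, ht⟩ _
  refine ⟨k ⊔ l, IntermediateField.finiteDimensional_sup k l, fun y hy => ?_⟩
  exact Set.subset_inter (hs.mono le_sup_left y hy.1) (ht.mono le_sup_right y hy.2)

/-- The sets Y(k, v) are a base and not only a subbase: an intersection is handled by the compositum
of the two fields. -/
theorem exists_over_subset {U : Set Place} (hU : IsOpen U) {y : Place} (hy : y ∈ U) :
    ∃ k : IntermediateField ℚ QBar, FiniteDimensional ℚ k ∧ Place.over k y ⊆ U := by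
  induction hU with
  | basic s hs =>
    obtain ⟨k, z, hk, rfl⟩ := hs
    exact ⟨k, hk, (Place.over_eq_of_mem hy).subset⟩
  | univ => exact ⟨⊥, inferInstance, Set.subset_univ _⟩
  | inter s t _ _ ihs iht =>
    obtain ⟨k, hk, h1⟩ := ihs hy.1
    obtain ⟨l, hl, h2⟩ := iht hy.2
    exact ⟨k ⊔ l, IntermediateField.finiteDimensional_sup k l, Set.subset_inter
      ((Place.over_anti le_sup_left y).trans h1) ((Place.over_anti le_sup_right y).trans h2)⟩
  | sUnion S _ ih =>
    obtain ⟨s, hs, hys⟩ := hy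
    obtain ⟨k, hk, h⟩ := ih s hs hys
    exact ⟨k, hk, h.trans (Set.subset_sUnion_of_mem hs)⟩

theorem countable_numberFields :
    {k : IntermediateField ℚ QBar | FiniteDimensional ℚ k}.Countable := by
  refine (Set.countable_range fun a : QBar => IntermediateField.adjoin ℚ {a}).mono ?_
  intro k hk
  obtain ⟨α, hα⟩ := @Field.exists_primitive_element ℚ k _ _ k.algebra' hk inferInstance
  exact ⟨(α : QBar), by
    beta_reduce
    rw [← IntermediateField.lift_adjoin_simple, hα, IntermediateField.lift_top]⟩

/-- An open `U` is the union, over the countably many number fields `k`, of the largest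
`k`-saturated subsets of `U`. -/
theorem borel_eq_generateFrom_saturatedSets :
    borel Place = MeasurableSpace.generateFrom saturatedSets := by
  apply le_antisymm
  · refine MeasurableSpace.generateFrom_le fun U hU => ?_
    have h : U = ⋃ k ∈ {k : IntermediateField ℚ QBar | FiniteDimensional ℚ k},
        {y | Place.over k y ⊆ U} := by
      ext y
      simp only [Set.mem_iUnion]
      constructor
      · intro hy
        obtain ⟨k, hk, h⟩ := exists_over_subset hU hy
        exact ⟨k, hk, h⟩
      · rintro ⟨k, _, h⟩
        exact h (Place.self_mem_over k y)
    rw [h]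
    refine MeasurableSet.biUnion countable_numberFields fun k hk =>
      MeasurableSpace.measurableSet_generateFrom ⟨k, hk, fun y hy z hz => ?_⟩
    change Place.over k z ⊆ U
    rw [Place.over_eq_of_mem hz]
    exact hy
  · refine MeasurableSpace.generateFrom_le ?_
    rintro s ⟨k, hk, hs⟩
    exact MeasurableSpace.measurableSet_generateFrom hs.isOpen

/-- A π-λ argument. Intersecting with the places over `u` keeps all measures finite, so that
complements become differences of integrable indicators. -/
theorem classMem_indicator_inter (hM : IsClosed (M : Set (Lp ℝ 1 weilMeasure)))
    (hballs : ∀ k : IntermediateField ℚ QBar, FiniteDimensional ℚ k → ∀ u (g : GalQ),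
      ClassMem M ((Place.over k (g • basePlace u)).indicator fun _ => 1))
    (u : Option Nat.Primes) (s : Set Place) (hs : MeasurableSet s) :
    ClassMem M ((s ∩ placesOver u).indicator fun _ => 1) := by
  induction s, hs using MeasurableSpace.induction_on_inter
    borel_eq_generateFrom_saturatedSets isPiSystem_saturatedSets with
  | empty =>
    rw [Set.empty_inter, Set.indicator_empty]
    exact ClassMem.zero
  | basic s hs =>
    obtain ⟨k, hk, hs⟩ := hs
    exact classMem_indicator_saturated (hballs k hk) hs u
  | compl s _ ih =>
    have h1 : ClassMem M ((Set.univ ∩ placesOver u).indicator fun _ => 1) :=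
      classMem_indicator_saturated (hballs ⊥ inferInstance) (fun _ _ => Set.subset_univ _) u
    convert h1.sub ih using 1
    ext y
    by_cases h1 : y ∈ placesOver u <;> by_cases h2 : y ∈ s <;> simp [h1, h2]
  | iUnion f hd hf ih =>
    rw [Set.iUnion_inter]
    exact classMem_iUnion hM (fun i => (hf i).inter (measurableSet_placesOver u))
      (fun i j hij => (hd hij).mono Set.inter_subset_left Set.inter_subset_left)
      (measure_ne_top_of_subset_placesOver (u := u)
        (Set.iUnion_subset fun i => Set.inter_subset_right)) ih

/-- A closed subspace of `L¹` that contains the indicator functions of almost all sets `Y(k, v)`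
is everything. -/
theorem mem_of_classMem_over (hM : IsClosed (M : Set (Lp ℝ 1 weilMeasure)))
    (hballs : ∀ k : IntermediateField ℚ QBar, FiniteDimensional ℚ k → ∀ u (g : GalQ),
      ClassMem M ((Place.over k (g • basePlace u)).indicator fun _ => 1))
    (F : Lp ℝ 1 weilMeasure) : F ∈ M := by
  refine Lp.induction ENNReal.one_ne_top (fun F => F ∈ M) (fun c s hs hμ => ?_)
    (fun f g _ _ _ hf hg => M.add_mem hf hg) hM F
  rw [Lp.simpleFunc.coe_indicatorConst]
  -- Cutting along the countably many places of ℚ recovers `s` up to a null set.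
  have h1 : ClassMem M ((⋃ u, s ∩ placesOver u).indicator fun _ => 1) :=
    classMem_iUnion hM (fun u => hs.inter (measurableSet_placesOver u))
      (fun u v huv => Set.disjoint_left.2 fun y h1 h2 => huv (eq_of_mem_placesOver h1.2 h2.2))
      (measure_ne_top_of_subset (Set.iUnion_subset fun u => Set.inter_subset_left) hμ.ne)
      fun u => classMem_indicator_inter hM hballs u s hs
  obtain ⟨hi, hm⟩ := (h1.smul c).congr (h' := s.indicator fun _ => c) (ae_weilMeasure fun u g => by
    by_cases h : g • basePlace u ∈ s
    · have : g • basePlace u ∈ ⋃ u, s ∩ placesOver u :=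
        Set.mem_iUnion.2 ⟨u, h, smul_basePlace_mem g u⟩
      simp [h, this]
    · have : g • basePlace u ∉ ⋃ u, s ∩ placesOver u := fun h' => by
        obtain ⟨v, hv⟩ := Set.mem_iUnion.1 h'
        exact h hv.1
      rw [Pi.smul_apply, Set.indicator_of_notMem h, Set.indicator_of_notMem this, smul_zero])
  exact hm

end

/-! ### The closure of the space of functions `f_α` -/

/-- The closure of the `ℚ`-vector space of the functions `f_α`, as a real subspace. -/
def closureF : Submodule ℝ XSpace where
  carrier := closure (FSpace : Set XSpace)
  zero_mem' := subset_closure FSpace.zero_mem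
  add_mem' := fun h h' => FSpace.toAddSubgroup.topologicalClosure.add_mem h h'
  smul_mem' := by
    intro c F hF
    have h1 : ∀ q : ℚ, (q : ℝ) • F ∈ closure (FSpace : Set XSpace) := by
      intro q
      refine map_mem_closure (f := fun F : XSpace => (q : ℝ) • F) (continuous_const_smul _) hF
        fun H hH => ?_
      change (q : ℝ) • H ∈ FSpace
      rw [Rat.cast_smul_eq_qsmul ℝ]
      exact FSpace.smul_mem q hH
    have h2 : IsClosed {c : ℝ | c • F ∈ closure (FSpace : Set XSpace)} :=
      isClosed_closure.preimage (continuous_id.smul continuous_const)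
    -- Rational scalars suffice, since the admissible real scalars form a closed set.
    exact Rat.denseRange_cast.induction_on (p := fun c : ℝ =>
      c • F ∈ closure (FSpace : Set XSpace)) c h2 h1

/-- The class of the indicator function of the set of archimedean places. -/
noncomputable def archClass : Lp ℝ 1 weilMeasure :=
  indicatorConstLp 1 (measurableSet_placesOver none)
    (measure_ne_top_of_subset_placesOver (subset_refl (placesOver none))) (1 : ℝ)

theorem integral_archClass : ∫ y, archClass y ∂weilMeasure = 1 := by
  rw [archClass, integral_indicatorConstLp, measureReal_def, weilMeasure_placesOver]
  simp

/-- A projection of `L¹` onto `X`. -/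
noncomputable def projX : Lp ℝ 1 weilMeasure →L[ℝ] XSpace :=
  (ContinuousLinearMap.id ℝ (Lp ℝ 1 weilMeasure) -
    (L1.integralCLM (E := ℝ) (μ := weilMeasure)).smulRight archClass).codRestrict XSpace (by
      intro F
      have hF : L1.integralCLM F = ∫ y, F y ∂weilMeasure :=
        (L1.integral_eq F).symm.trans (L1.integral_eq_integral F)
      rw [mem_XSpace]
      change ∫ y, (F - L1.integralCLM F • archClass : Lp ℝ 1 weilMeasure) y ∂weilMeasure = 0
      rw [integral_congr_ae (Lp.coeFn_sub _ _)]
      have h1 := integral_sub (L1.integrable_coeFn F)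
        (L1.integrable_coeFn (L1.integralCLM F • archClass))
      refine h1.trans ?_
      rw [integral_congr_ae (Lp.coeFn_smul _ _)]
      simp only [Pi.smul_apply]
      rw [integral_smul, integral_archClass, hF]
      simp)

theorem coe_projX (F : Lp ℝ 1 weilMeasure) :
    (projX F : Lp ℝ 1 weilMeasure) = F - (∫ y, F y ∂weilMeasure) • archClass := by
  rw [← L1.integral_eq_integral F, L1.integral_eq]
  rfl

theorem projX_coe (F : XSpace) : projX F = F := by
  refine Subtype.ext ?_
  rw [coe_projX, (mem_XSpace F).1 F.2, zero_smul, sub_zero]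

/-- The subspace of all `F` in `L¹` whose projection to `X` is a limit of functions `f_α`. -/
noncomputable def limitSpace : Submodule ℝ (Lp ℝ 1 weilMeasure) :=
  closureF.comap projX.toLinearMap

theorem isClosed_limitSpace : IsClosed (limitSpace : Set (Lp ℝ 1 weilMeasure)) :=
  (isClosed_closure (s := (FSpace : Set XSpace))).preimage projX.continuous

theorem classMem_logAbs (a : QBarˣ) : ClassMem limitSpace (logAbs a) := by
  refine ⟨integrable_logAbs a, ?_⟩
  have h : projX (fVec (a : G) : XSpace) ∈ closureF := by
    rw [projX_coe]
    exact subset_closure (fVec_mem _)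
  exact h

/-- The projection to X kills this class, so multiples of it may be added freely to adjust an
integral. -/
theorem classMem_archClass :
    ClassMem limitSpace ((placesOver none).indicator fun _ => (1 : ℝ)) := by
  rw [classMem_indicator_iff (measurableSet_placesOver none)
    (measure_ne_top_of_subset_placesOver (subset_refl (placesOver none)))]
  change projX archClass ∈ closureF
  have : projX archClass = 0 := by
    refine Subtype.ext ?_
    rw [coe_projX, integral_archClass, one_smul, sub_self]
    rfl
  rw [this]
  exact closureF.zero_mem

theorem closure_FSpace_of_forall_mem (h : ∀ F, F ∈ limitSpace) :
    closure (FSpace : Set XSpace) = Set.univ := by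
  refine Set.eq_univ_of_forall fun F => ?_
  have h1 : projX F ∈ closureF := h F
  rwa [projX_coe] at h1

/-- The error `C` does not grow with n, so after division by n it tends to 0, and F is stable under
division by n. -/
theorem classMem_of_approx {h : Place → ℝ} (hi : Integrable h weilMeasure)
    (h0 : ∫ y, h y ∂weilMeasure = 0) {C : ℝ}
    (hC : ∀ n : ℕ, ∃ a : QBarˣ, ∫ y, ‖logAbs a y - n * h y‖ ∂weilMeasure ≤ C) :
    ClassMem limitSpace h := by
  refine ⟨hi, ?_⟩
  have hx : hi.toL1 h ∈ XSpace := by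
    rw [mem_XSpace, integral_congr_ae hi.coeFn_toL1, h0]
  have key : (⟨hi.toL1 h, hx⟩ : XSpace) ∈ closure (FSpace : Set XSpace) := by
    rw [Metric.mem_closure_iff]
    intro ε hε
    obtain ⟨n, hn⟩ := exists_nat_gt (C / ε)
    -- The shift by 1 keeps the divisor nonzero.
    obtain ⟨a, ha⟩ := hC (n + 1)
    refine ⟨((n + 1 : ℕ) : ℚ)⁻¹ • fVec (a : G), FSpace.smul_mem _ (fVec_mem _), ?_⟩
    have hn0 : (0 : ℝ) < (n + 1 : ℕ) := by positivity
    have e1 : (⟨hi.toL1 h, hx⟩ : XSpace) - ((n + 1 : ℕ) : ℚ)⁻¹ • fVec (a : G) =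
        (-((n + 1 : ℕ) : ℝ)⁻¹) • (fVec (a : G) - ((n + 1 : ℕ) : ℝ) • ⟨hi.toL1 h, hx⟩) := by
      rw [← Rat.cast_smul_eq_qsmul ℝ, smul_sub, smul_smul, neg_mul, inv_mul_cancel₀ hn0.ne']
      simp only [Rat.cast_inv, Rat.cast_natCast, neg_smul, one_smul]
      abel
    have e2 : ‖fVec (a : G) - ((n + 1 : ℕ) : ℝ) • (⟨hi.toL1 h, hx⟩ : XSpace)‖ ≤ C := by
      have hi' : Integrable (fun y => logAbs a y - ((n + 1 : ℕ) : ℝ) * h y) weilMeasure :=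
        (integrable_logAbs a).sub (hi.const_mul _)
      have e3 : ((fVec (a : G) - ((n + 1 : ℕ) : ℝ) • (⟨hi.toL1 h, hx⟩ : XSpace) : XSpace) :
          Lp ℝ 1 weilMeasure) = hi'.toL1 _ := by
        refine Eq.trans ?_ (Integrable.toL1_sub _ _ (integrable_logAbs a) (hi.const_mul _)).symm
        exact congrArg (fun H => (integrable_logAbs a).toL1 (logAbs a) - H)
          (Integrable.toL1_smul h hi ((n + 1 : ℕ) : ℝ)).symm
      rw [Submodule.coe_norm, e3, L1.norm_of_fun_eq_integral_norm]
      exact ha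
    rw [dist_eq_norm, e1, norm_smul, norm_neg, norm_inv, Real.norm_of_nonneg hn0.le,
      inv_mul_lt_iff₀ hn0]
    refine e2.trans_lt ?_
    rw [div_lt_iff₀ hε] at hn
    refine hn.trans ?_
    push_cast
    nlinarith
  have h2 : projX (hi.toL1 h) = ⟨hi.toL1 h, hx⟩ := projX_coe ⟨hi.toL1 h, hx⟩
  change projX (hi.toL1 h) ∈ closureF
  rw [h2]
  exact key

/-! ### Functions on the archimedean places of a number field -/

instance (k : IntermediateField ℚ QBar) [h : FiniteDimensional ℚ k] : NumberField k where
  to_charZero := inferInstance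
  to_finiteDimensional := by
    convert h

section
open NumberField
variable (k : IntermediateField ℚ QBar)

/-- The embedding of the number field `k` in `ℂ` that defines the place `g • archPlace`. -/
noncomputable def archEmbedding (g : GalQ) : k →+* ℂ :=
  (((IsAlgClosed.lift : QBar →ₐ[ℚ] ℂ) : QBar →+* ℂ).comp ((g⁻¹ : GalQ) : QBar →+* QBar)).comp
    (algebraMap k QBar)

theorem smul_archPlace_abv (g : GalQ) (a : k) :
    (g • archPlace).abv (a : QBar) = InfinitePlace.mk (archEmbedding k g) a := rfl

theorem smul_padicPlace_le_one (p : Nat.Primes) (g : GalQ) (a : 𝓞 k) :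
    (g • padicPlace p).abv ((a : k) : QBar) ≤ 1 := by
  rw [Place.smul_abv]
  refine padicPlace_le_one p ?_
  have h1 : IsIntegral ℤ (a : k) := a.isIntegral_coe
  have h2 : IsIntegral ℤ (((a : k) : QBar)) := h1.map (algebraMap k QBar).toIntAlgHom
  exact h2.map ((g⁻¹ : GalQ) : QBar →+* QBar).toIntAlgHom

variable [FiniteDimensional ℚ k]

/-- Minkowski's convex body theorem for the box |a|_w < B exp(n x_w): since the weighted sum of `x`
is 0, its volume does not depend on n, and one `B` serves all n. The element found is a nonzero
integer of `k`, not necessarily a unit. -/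
theorem exists_unit_logAbs_le (x : InfinitePlace k → ℝ) (hx : ∑ w, (w.mult : ℝ) * x w = 0) :
    ∃ C : ℝ, 0 ≤ C ∧ ∀ n : ℕ, ∃ a : QBarˣ,
      (∀ g : GalQ, logAbs a (g • archPlace) ≤ n * x (InfinitePlace.mk (archEmbedding k g)) + C) ∧
      ∀ (p : Nat.Primes) (g : GalQ), logAbs a (g • padicPlace p) ≤ 0 := by
  classical
  -- The summand 1 makes the Minkowski inequality strict and gives B ≥ 1, hence log B ≥ 0 and B ≤ B
  -- ^ [k : ℚ].
  set B : NNReal := (mixedEmbedding.minkowskiBound k ↑1).toNNReal + 1 with hB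
  have hB1 : 1 ≤ B := by simp [hB]
  have hB0 : 0 < B := one_pos.trans_le hB1
  refine ⟨Real.log B, Real.log_nonneg (by exact_mod_cast hB1), fun n => ?_⟩
  let f : InfinitePlace k → NNReal := fun w => (Real.exp (n * x w)).toNNReal * B
  have hprod : ∏ w, f w ^ w.mult = B ^ Module.finrank ℚ k := by
    simp only [f, mul_pow]
    rw [Finset.prod_mul_distrib, Finset.prod_pow_eq_pow_sum, InfinitePlace.sum_mult_eq]
    have : ∏ w : InfinitePlace k, (Real.exp (n * x w)).toNNReal ^ w.mult
        = 1 := by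
      refine NNReal.eq ?_
      push_cast
      simp only [Real.coe_toNNReal _ (Real.exp_pos _).le, ← Real.exp_nat_mul]
      rw [← Real.exp_sum]
      have : ∑ w : InfinitePlace k, (w.mult : ℝ) * (n * x w) = n * ∑ w, (w.mult : ℝ) * x w := by
        rw [Finset.mul_sum]
        exact Finset.sum_congr rfl fun w _ => by ring
      rw [this, hx, mul_zero, Real.exp_zero]
    rw [this, one_mul]
  have hmink : mixedEmbedding.minkowskiBound k ↑1 < volume (mixedEmbedding.convexBodyLT k f) := by
    rw [mixedEmbedding.convexBodyLT_volume, hprod]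
    have h1 : mixedEmbedding.minkowskiBound k ↑1 < (B : ENNReal) := by
      rw [hB, ENNReal.coe_add,
        ENNReal.coe_toNNReal (mixedEmbedding.minkowskiBound_lt_top k _).ne]
      exact ENNReal.lt_add_right (mixedEmbedding.minkowskiBound_lt_top k _).ne (by simp)
    refine h1.trans_le ?_
    rw [← ENNReal.coe_mul, ENNReal.coe_le_coe]
    calc B ≤ B ^ Module.finrank ℚ k := le_self_pow₀ hB1 Module.finrank_pos.ne'
      _ ≤ _ := le_mul_of_one_le_left zero_le (mixedEmbedding.one_le_convexBodyLTFactor k)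
  obtain ⟨a, ha0, ha⟩ := mixedEmbedding.exists_ne_zero_mem_ringOfIntegers_lt k hmink
  have ha0' : ((a : k) : QBar) ≠ 0 := by
    simpa using ha0
  refine ⟨Units.mk0 _ ha0', fun g => ?_, fun p g => ?_⟩
  · have h1 := ha (InfinitePlace.mk (archEmbedding k g))
    change Real.log ((g • archPlace).abv ((a : k) : QBar)) ≤ _
    have hpos : 0 < (g • archPlace).abv ((a : k) : QBar) := AbsoluteValue.pos _ ha0'
    rw [smul_archPlace_abv] at hpos ⊢
    have h2 := Real.log_le_log hpos h1.le
    refine h2.trans (le_of_eq ?_)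
    simp only [f, NNReal.coe_mul, Real.coe_toNNReal _ (Real.exp_pos _).le]
    rw [Real.log_mul (Real.exp_pos _).ne' (by exact_mod_cast hB0.ne'), Real.log_exp]
  · exact Real.log_nonpos (AbsoluteValue.nonneg _ _) (smul_padicPlace_le_one k p g a)

variable {k}

theorem integrable_of_arch {h : Place → ℝ} {x : InfinitePlace k → ℝ} (hc : Continuous h)
    (harch : ∀ g : GalQ, h (g • archPlace) = x (InfinitePlace.mk (archEmbedding k g)))
    (hpadic : ∀ (p : Nat.Primes) (g : GalQ), h (g • padicPlace p) = 0) :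
    Integrable h weilMeasure := by
  have hi : Integrable ((placesOver none).indicator fun _ => ∑ w, |x w|) weilMeasure :=
    (integrableOn_const (measure_ne_top_of_subset_placesOver (subset_refl _))).integrable_indicator
      (measurableSet_placesOver none)
  refine hi.mono' hc.measurable.aestronglyMeasurable (ae_weilMeasure fun u g => ?_)
  cases u with
  | none =>
    rw [Set.indicator_of_mem (smul_basePlace_mem g none)]
    change ‖h (g • archPlace)‖ ≤ _
    rw [harch, Real.norm_eq_abs]
    exact Finset.single_le_sum (f := fun w => |x w|) (fun w _ => abs_nonneg _) (Finset.mem_univ _)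
  | some p =>
    change ‖h (g • padicPlace p)‖ ≤ _
    rw [hpadic, norm_zero]
    exact Set.indicator_nonneg (fun _ _ => Finset.sum_nonneg fun w _ => abs_nonneg _) _

/-- Minkowski's theorem and the product formula: a function on the archimedean places of `k` whose
weighted sum vanishes is approximated by functions `f_α` up to a bounded error, after scaling. -/
theorem exists_integral_norm_sub_le {h : Place → ℝ} {x : InfinitePlace k → ℝ} (hc : Continuous h)
    (harch : ∀ g : GalQ, h (g • archPlace) = x (InfinitePlace.mk (archEmbedding k g)))
    (hpadic : ∀ (p : Nat.Primes) (g : GalQ), h (g • padicPlace p) = 0)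
    (hx : ∑ w, (w.mult : ℝ) * x w = 0) :
    ∃ C : ℝ, ∀ n : ℕ, ∃ a : QBarˣ, ∫ y, ‖logAbs a y - n * h y‖ ∂weilMeasure ≤
      C + n * ∫ y, h y ∂weilMeasure := by
  have hi := integrable_of_arch hc harch hpadic
  obtain ⟨C, hC, hCn⟩ := exists_unit_logAbs_le k x hx
  refine ⟨2 * C, fun n => ?_⟩
  obtain ⟨a, h1, h2⟩ := hCn n
  refine ⟨a, ?_⟩
  have hie : Integrable ((placesOver none).indicator fun _ => 2 * C) weilMeasure :=
    (integrableOn_const (measure_ne_top_of_subset_placesOver (subset_refl _))).integrable_indicator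
      (measurableSet_placesOver none)
  have hie1 : ∫ y, (placesOver none).indicator (fun _ => 2 * C) y ∂weilMeasure = 2 * C := by
    rw [integral_indicator_const _ (measurableSet_placesOver none), measureReal_def,
      weilMeasure_placesOver]
    simp
  have hid : Integrable (fun y => logAbs a y - n * h y) weilMeasure :=
    (integrable_logAbs a).sub (hi.const_mul _)
  -- A bound t ≤ C with C ≥ 0 gives |t| ≤ 2C - t, and t ≤ 0 gives |t| = -t. In the integral of the
  -- right side, the logarithm drops out by the product formula.
  have hle : ∀ᵐ y ∂weilMeasure, ‖logAbs a y - n * h y‖ ≤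
      (placesOver none).indicator (fun _ => 2 * C) y - (logAbs a y - n * h y) := by
    refine ae_weilMeasure fun u g => ?_
    cases u with
    | none =>
      rw [Set.indicator_of_mem (smul_basePlace_mem g none), Real.norm_eq_abs, abs_le]
      have := h1 g
      rw [← harch] at this
      change logAbs a (g • basePlace none) ≤ n * h (g • basePlace none) + C at this
      constructor <;> linarith
    | some p =>
      have h0 : g • basePlace (some p) ∉ placesOver none := fun h' =>
        Option.some_ne_none p (eq_of_mem_placesOver (smul_basePlace_mem g (some p)) h')
      have e1 : h (g • basePlace (some p)) = 0 := hpadic p g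
      have e2 : logAbs a (g • basePlace (some p)) ≤ 0 := h2 p g
      rw [Set.indicator_of_notMem h0, e1, mul_zero, sub_zero, zero_sub, Real.norm_of_nonpos e2]
  refine (integral_mono_ae hid.norm (hie.sub hid) hle).trans (le_of_eq ?_)
  rw [integral_sub' hie hid, hie1, integral_sub (integrable_logAbs a) (hi.const_mul _),
    integral_logAbs, integral_const_mul]
  ring

/-- No computation of the measure of Y(k, v) is needed: were the integral negative, the bound C + n
∫ h for an integral of norms would be negative for large n. The same applies to -h. -/
theorem integral_eq_zero_of_arch {h : Place → ℝ} {x : InfinitePlace k → ℝ} (hc : Continuous h)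
    (harch : ∀ g : GalQ, h (g • archPlace) = x (InfinitePlace.mk (archEmbedding k g)))
    (hpadic : ∀ (p : Nat.Primes) (g : GalQ), h (g • padicPlace p) = 0)
    (hx : ∑ w, (w.mult : ℝ) * x w = 0) : ∫ y, h y ∂weilMeasure = 0 := by
  have key : ∀ {h : Place → ℝ} {x : InfinitePlace k → ℝ}, Continuous h →
      (∀ g : GalQ, h (g • archPlace) = x (InfinitePlace.mk (archEmbedding k g))) →
      (∀ (p : Nat.Primes) (g : GalQ), h (g • padicPlace p) = 0) →
      ∑ w, (w.mult : ℝ) * x w = 0 → 0 ≤ ∫ y, h y ∂weilMeasure := by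
    intro h x hc harch hpadic hx
    obtain ⟨C, hC⟩ := exists_integral_norm_sub_le hc harch hpadic hx
    by_contra! hneg
    obtain ⟨n, hn⟩ := exists_nat_gt (C / -∫ y, h y ∂weilMeasure)
    obtain ⟨a, ha⟩ := hC n
    have h1 := (integral_nonneg fun y => norm_nonneg (logAbs a y - n * h y)).trans ha
    rw [div_lt_iff₀ (by linarith)] at hn
    linarith
  refine le_antisymm ?_ (key hc harch hpadic hx)
  have := key (h := -h) (x := -x) hc.neg (fun g => congrArg Neg.neg (harch g))
    (fun p g => by rw [Pi.neg_apply, hpadic, neg_zero]) (by simp [hx])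
  have e : ∫ y, (-h) y ∂weilMeasure = -∫ y, h y ∂weilMeasure := integral_neg h
  linarith

/-- Subtracting a constant on the archimedean places makes the weighted sum 0, and the constant part
is admissible by `classMem_archClass`. -/
theorem classMem_of_arch {h : Place → ℝ} (hk : ∀ y, ∀ z ∈ Place.over k y, h z = h y)
    (h0 : ∀ y ∉ placesOver none, h y = 0) : ClassMem limitSpace h := by
  classical
  have hopen : ∀ {h : Place → ℝ}, (∀ y, ∀ z ∈ Place.over k y, h z = h y) → Continuous h := by
    intro h hk
    refine continuous_def.2 fun U _ => IsSaturated.isOpen (k := k) fun y hy z hz => ?_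
    change h z ∈ U
    rwa [hk y z hz]
  -- The value 0 at a `w` not induced by any g • archPlace is arbitrary: only the values at induced
  -- places are compared with `h`.
  let x : InfinitePlace k → ℝ := fun w =>
    if hw : ∃ g : GalQ, InfinitePlace.mk (archEmbedding k g) = w then h (hw.choose • archPlace)
    else 0
  have hx : ∀ g : GalQ, h (g • archPlace) = x (InfinitePlace.mk (archEmbedding k g)) := by
    intro g
    have hw : ∃ g' : GalQ, InfinitePlace.mk (archEmbedding k g') =
        InfinitePlace.mk (archEmbedding k g) := ⟨g, rfl⟩
    simp only [x, dif_pos hw]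
    refine hk _ _ fun a ha => ?_
    rw [smul_archPlace_abv k g ⟨a, ha⟩, smul_archPlace_abv k hw.choose ⟨a, ha⟩, hw.choose_spec]
  -- The weighted mean of `x`; the weights add up to [k : ℚ].
  set s : ℝ := (Module.finrank ℚ k : ℝ)⁻¹ * ∑ w, (w.mult : ℝ) * x w with hs
  let h' : Place → ℝ := h - s • (placesOver none).indicator fun _ => 1
  have hk' : ∀ y, ∀ z ∈ Place.over k y, h' z = h' y := by
    intro y z hz
    have : z ∈ placesOver none ↔ y ∈ placesOver none := Place.mem_over_iff_of_mem bot_le hz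
    simp only [h', Pi.sub_apply, Pi.smul_apply, Set.indicator_apply, hk y z hz, this]
  have harch' : ∀ g : GalQ, h' (g • archPlace) =
      (fun w => x w - s) (InfinitePlace.mk (archEmbedding k g)) := by
    intro g
    have : g • archPlace ∈ placesOver none := smul_basePlace_mem g none
    simp [h', this, hx]
  have hpadic' : ∀ (p : Nat.Primes) (g : GalQ), h' (g • padicPlace p) = 0 := by
    intro p g
    have : g • padicPlace p ∉ placesOver none := fun h' =>
      Option.some_ne_none p (eq_of_mem_placesOver (smul_basePlace_mem g (some p)) h')
    simp [h', this, h0 _ this]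
  have hsum : ∑ w : InfinitePlace k, (w.mult : ℝ) * (x w - s) = 0 := by
    have hd : (Module.finrank ℚ k : ℝ) ≠ 0 := by
      exact_mod_cast (Module.finrank_pos (R := ℚ) (M := k)).ne'
    have h1 : ∑ w : InfinitePlace k, (w.mult : ℝ) = Module.finrank ℚ k := by
      exact_mod_cast InfinitePlace.sum_mult_eq (K := k)
    simp only [mul_sub]
    rw [Finset.sum_sub_distrib, ← Finset.sum_mul, h1, hs, mul_inv_cancel_left₀ hd, sub_self]
  have hint := integral_eq_zero_of_arch (hopen hk') harch' hpadic' hsum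
  obtain ⟨C, hC⟩ := exists_integral_norm_sub_le (hopen hk') harch' hpadic' hsum
  have hmem : ClassMem limitSpace h' :=
    classMem_of_approx (integrable_of_arch (x := fun w => x w - s) (hopen hk') harch' hpadic') hint (C := C) (by
      simpa [hint] using hC)
  have := hmem.add (classMem_archClass.smul s)
  simpa [h'] using this

end

/-! ### Non-archimedean places and prime ideals -/

theorem smul_padicPlace_add_le (p : Nat.Primes) (g : GalQ) (a b : QBar) :
    (g • padicPlace p).abv (a + b) ≤
      max ((g • padicPlace p).abv a) ((g • padicPlace p).abv b) := by
  have : Fact (p : ℕ).Prime := ⟨p.2⟩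
  rw [Place.smul_abv, Place.smul_abv, Place.smul_abv, map_add]
  change ‖(IsAlgClosed.lift : QBar →ₐ[ℚ] PadicAlgCl p) (g⁻¹ a + g⁻¹ b)‖ ≤ _
  rw [map_add]
  exact PadicAlgCl.isNonarchimedean p _ _

section
open NumberField
variable (k : IntermediateField ℚ QBar)

/-- The prime ideal of the ring of integers of `k` that is defined by a non-archimedean place. -/
noncomputable def residueIdeal (p : Nat.Primes) (g : GalQ) : Ideal (𝓞 k) where
  carrier := {a | (g • padicPlace p).abv ((a : k) : QBar) < 1}
  zero_mem' := by simp
  add_mem' := fun {a b} ha hb => by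
    have h := smul_padicPlace_add_le p g ((a : k) : QBar) ((b : k) : QBar)
    have h' := h.trans_lt (max_lt ha hb)
    simpa using h'
  smul_mem' := fun c a ha => by
    have h := mul_lt_one_of_nonneg_of_lt_one_right (smul_padicPlace_le_one k p g c)
      (AbsoluteValue.nonneg _ _) ha
    rw [← map_mul] at h
    simpa using h

theorem mem_residueIdeal (p : Nat.Primes) (g : GalQ) (a : 𝓞 k) :
    a ∈ residueIdeal k p g ↔ (g • padicPlace p).abv ((a : k) : QBar) < 1 := Iff.rfl

theorem abv_eq_one_iff (p : Nat.Primes) (g : GalQ) (a : 𝓞 k) :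
    (g • padicPlace p).abv ((a : k) : QBar) = 1 ↔ a ∉ residueIdeal k p g := by
  rw [mem_residueIdeal, not_lt]
  exact ⟨fun h => h.ge, fun h => le_antisymm (smul_padicPlace_le_one k p g a) h⟩

theorem abv_natCast (p : Nat.Primes) (g : GalQ) (n : ℕ) :
    (g • padicPlace p).abv (((n : 𝓞 k) : k) : QBar) = (padicNorm p n : ℝ) := by
  rw [Place.smul_abv, ← padicPlace_rat p n]
  simp

theorem natCast_mem_residueIdeal (p q : Nat.Primes) (g : GalQ) :
    ((q : ℕ) : 𝓞 k) ∈ residueIdeal k p g ↔ p = q := by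
  have : Fact (p : ℕ).Prime := ⟨p.2⟩
  have : Fact (q : ℕ).Prime := ⟨q.2⟩
  rw [mem_residueIdeal, abv_natCast]
  constructor
  · intro h
    by_contra hne
    have hne' : (p : ℕ) ≠ q := fun h => hne (Subtype.ext h)
    rw [padicNorm.padicNorm_of_prime_of_ne hne'] at h
    simp at h
  · rintro rfl
    have : padicNorm (p : ℕ) ((p : ℕ) : ℚ) < 1 := padicNorm.padicNorm_p_lt_one_of_prime
    exact_mod_cast this

instance isPrime_residueIdeal (p : Nat.Primes) (g : GalQ) : (residueIdeal k p g).IsPrime where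
  ne_top' := by
    rw [Ideal.ne_top_iff_one, ← abv_eq_one_iff]
    simp
  mem_or_mem' := fun {a b} h => by
    by_contra! hab
    rw [← abv_eq_one_iff, ← abv_eq_one_iff] at hab
    refine (abv_eq_one_iff k p g (a * b)).1 ?_ h
    simp [hab.1, hab.2]

theorem residueIdeal_ne_bot (p : Nat.Primes) (g : GalQ) : residueIdeal k p g ≠ ⊥ := by
  intro h
  have := (natCast_mem_residueIdeal k p p g).2 rfl
  rw [h, Ideal.mem_bot] at this
  exact p.2.ne_zero (by exact_mod_cast this)

/-! ### Finiteness of the class group -/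

variable [FiniteDimensional ℚ k]

theorem exists_pow_eq_span (I : Ideal (𝓞 k)) (hI : I ≠ ⊥) :
    ∃ a : 𝓞 k, I ^ classNumber k = Ideal.span {a} := by
  have h0 : I ^ classNumber k ∈ nonZeroDivisors (Ideal (𝓞 k)) :=
    pow_mem (mem_nonZeroDivisors_of_ne_zero hI) _
  have h1 : (I ^ classNumber k).IsPrincipal := by
    rw [← ClassGroup.mk0_eq_one_iff h0, ← SubmonoidClass.mk_pow I
      (mem_nonZeroDivisors_of_ne_zero hI), map_pow]
    exact pow_card_eq_one
  exact ⟨_, (Submodule.IsPrincipal.span_singleton_generator _).symm⟩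

theorem classNumber_ne_zero : classNumber k ≠ 0 := Fintype.card_ne_zero

variable {k}

/-- Write (a) = P^m A with P not dividing A, and raise to the class number: up to a unit, the power
of `a` is ϖ^m b with b outside P. Units and b have absolute value 1 at every place with residue
ideal P, and m does not depend on the place. -/
theorem abv_pow_eq {P : Ideal (𝓞 k)} {ϖ : 𝓞 k} (hϖ : P ^ classNumber k = Ideal.span {ϖ})
    (hP : P.IsPrime) (hP0 : P ≠ ⊥) {a : 𝓞 k} (ha : a ≠ 0) :
    ∃ m : ℕ, ∀ (p : Nat.Primes) (g : GalQ), residueIdeal k p g = P →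
      (g • padicPlace p).abv ((a : k) : QBar) ^ classNumber k =
        (g • padicPlace p).abv ((ϖ : k) : QBar) ^ m := by
  have hspan : Ideal.span {a} ≠ ⊥ := by simpa using ha
  have hfm : FiniteMultiplicity P (Ideal.span {a}) :=
    FiniteMultiplicity.of_not_isUnit (Ideal.isUnit_iff.not.2 hP.ne_top) hspan
  obtain ⟨A, hA, hPA⟩ := hfm.exists_eq_pow_mul_and_not_dvd
  set m := multiplicity P (Ideal.span {a})
  have hA0 : A ≠ ⊥ := by
    rintro rfl
    exact hPA (dvd_zero P)
  obtain ⟨b, hb⟩ := exists_pow_eq_span k A hA0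
  have hbP : b ∉ P := by
    intro h
    apply hPA
    rw [Ideal.dvd_iff_le]
    have h1 : A ^ classNumber k ≤ P := by
      rw [hb]
      exact (Ideal.span_singleton_le_iff_mem P).2 h
    exact hP.le_of_pow_le h1
  have h1 : Ideal.span {a ^ classNumber k} = Ideal.span {ϖ ^ m * b} := by
    rw [← Ideal.span_singleton_pow, hA, mul_pow, ← pow_mul, mul_comm m, pow_mul, hϖ, hb,
      Ideal.span_singleton_pow, Ideal.span_singleton_mul_span_singleton]
  obtain ⟨c, hc⟩ := Ideal.span_singleton_eq_span_singleton.1 h1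
  refine ⟨m, ?_⟩
  rintro p g rfl
  have hb1 := (abv_eq_one_iff k p g b).2 hbP
  have hc1 := (abv_eq_one_iff k p g c).2 fun h =>
    hP.ne_top (Ideal.eq_top_of_isUnit_mem _ h c.isUnit)
  have h2 := congrArg (fun x : 𝓞 k => (g • padicPlace p).abv ((x : k) : QBar)) hc
  simpa [hb1, hc1] using h2

/-- By `abv_pow_eq` all absolute values are governed by that of ϖ, which is pinned down by the
normalized value at the rational prime `q`; the exponent there is nonzero because `q` lies in the
ideal. Fractions of integers then give all of `k`. -/
theorem mem_over_of_residueIdeal_eq {p q : Nat.Primes} {g g' : GalQ}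
    (h : residueIdeal k q g' = residueIdeal k p g) :
    g' • padicPlace q ∈ Place.over k (g • padicPlace p) := by
  have hpq : q = p := by
    rw [← natCast_mem_residueIdeal k q p g', h, natCast_mem_residueIdeal]
  subst hpq
  have : Fact (q : ℕ).Prime := ⟨q.2⟩
  obtain ⟨ϖ, hϖ⟩ := exists_pow_eq_span k _ (residueIdeal_ne_bot k q g)
  have hn := classNumber_ne_zero k
  have hpow := fun {a : 𝓞 k} (ha : a ≠ 0) => abv_pow_eq hϖ inferInstance
    (residueIdeal_ne_bot k q g) ha
  have hq0 : ((q : ℕ) : 𝓞 k) ≠ 0 := by exact_mod_cast q.2.ne_zero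
  have heqϖ : (g' • padicPlace q).abv ((ϖ : k) : QBar) =
      (g • padicPlace q).abv ((ϖ : k) : QBar) := by
    obtain ⟨m, hm⟩ := hpow hq0
    have hm0 : m ≠ 0 := by
      rintro rfl
      have h1 := hm q g rfl
      rw [pow_zero, pow_eq_one_iff_of_nonneg (AbsoluteValue.nonneg _ _) hn,
        abv_eq_one_iff] at h1
      exact h1 ((natCast_mem_residueIdeal k q q g).2 rfl)
    refine (pow_left_inj₀ (AbsoluteValue.nonneg _ _) (AbsoluteValue.nonneg _ _) hm0).1 ?_
    rw [← hm q g rfl, ← hm q g' h, abv_natCast, abv_natCast]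
  have hint : ∀ a : 𝓞 k, (g' • padicPlace q).abv ((a : k) : QBar) =
      (g • padicPlace q).abv ((a : k) : QBar) := by
    intro a
    by_cases ha : a = 0
    · simp [ha]
    obtain ⟨m, hm⟩ := hpow ha
    refine (pow_left_inj₀ (AbsoluteValue.nonneg _ _) (AbsoluteValue.nonneg _ _) hn).1 ?_
    rw [hm q g rfl, hm q g' h, heqϖ]
  intro a ha
  obtain ⟨x, y, -, hxy⟩ := IsFractionRing.div_surjective (A := 𝓞 k) (⟨a, ha⟩ : k)
  have e : a = ((x : k) : QBar) / ((y : k) : QBar) := by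
    have := congrArg (fun z : k => (z : QBar)) hxy
    simpa using this.symm
  rw [e, map_div₀, map_div₀, hint, hint]

/-- Finiteness of the class group yields an element of `k` that is a unit at all non-archimedean
places except for a given one. -/
theorem exists_logAbs_support (p : Nat.Primes) (g : GalQ) :
    ∃ a : QBarˣ, (a : QBar) ∈ k ∧ logAbs a (g • padicPlace p) ≠ 0 ∧
      ∀ (q : Nat.Primes) (g' : GalQ), g' • padicPlace q ∉ Place.over k (g • padicPlace p) →
        logAbs a (g' • padicPlace q) = 0 := by
  obtain ⟨ϖ, hϖ⟩ := exists_pow_eq_span k _ (residueIdeal_ne_bot k p g)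
  have hn := classNumber_ne_zero k
  have hϖ0 : ϖ ≠ 0 := by
    rintro rfl
    rw [Ideal.span_singleton_eq_bot.2 rfl] at hϖ
    exact residueIdeal_ne_bot k p g (eq_zero_of_pow_eq_zero hϖ)
  have h0 : ((ϖ : k) : QBar) ≠ 0 := by simpa using hϖ0
  refine ⟨Units.mk0 _ h0, (ϖ : k).2, ?_, fun q g' hq => ?_⟩
  · have hmem : ϖ ∈ residueIdeal k p g :=
      Ideal.pow_le_self hn (hϖ ▸ Ideal.mem_span_singleton_self ϖ)
    exact (Real.log_neg (AbsoluteValue.pos _ h0) hmem).ne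
  · have hnm : ϖ ∉ residueIdeal k q g' := by
      intro h
      apply hq
      -- If ϖ lay in another residue ideal, that prime would contain, and by maximality equal, the
      -- given one, so the two places would agree on `k`.
      have h1 : residueIdeal k p g ^ classNumber k ≤ residueIdeal k q g' := by
        rw [hϖ]
        exact (Ideal.span_singleton_le_iff_mem _).2 h
      have h2 := (isPrime_residueIdeal k q g').le_of_pow_le h1
      have h3 := (isPrime_residueIdeal k p g).isMaximal (residueIdeal_ne_bot k p g)
      exact mem_over_of_residueIdeal_eq
        (h3.eq_of_le (isPrime_residueIdeal k q g').ne_top h2).symm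
    change Real.log ((g' • padicPlace q).abv ((ϖ : k) : QBar)) = 0
    rw [(abv_eq_one_iff k q g' ϖ).2 hnm, Real.log_one]

/-- At a non-archimedean place, log|a| minus its archimedean part is almost everywhere a nonzero
multiple of the indicator. -/
theorem classMem_indicator_over (u : Option Nat.Primes) (g : GalQ) :
    ClassMem limitSpace ((Place.over k (g • basePlace u)).indicator fun _ => 1) := by
  classical
  cases u with
  | none =>
    refine classMem_of_arch (k := k) (fun y z hz => ?_) fun y hy =>
      Set.indicator_of_notMem (fun h => hy (over_subset_placesOver k g none h)) _
    simp only [Set.indicator_apply, Place.mem_over_iff_of_mem le_rfl hz]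
  | some p =>
    obtain ⟨a, hak, ha0, ha⟩ := exists_logAbs_support (k := k) p g
    have hconst : ∀ y, ∀ z ∈ Place.over k y, logAbs a z = logAbs a y :=
      fun y z hz => congrArg Real.log (hz _ hak)
    have h1 : ClassMem limitSpace ((placesOver none).indicator (logAbs a)) :=
      classMem_of_arch (k := k)
        (fun y z hz => by
          have : z ∈ placesOver none ↔ y ∈ placesOver none := Place.mem_over_iff_of_mem bot_le hz
          simp only [Set.indicator_apply, this, hconst y z hz])
        fun y hy => Set.indicator_of_notMem hy _
    refine (((classMem_logAbs a).sub h1).smul (logAbs a (g • padicPlace p))⁻¹).congr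
      (ae_weilMeasure fun v g' => ?_)
    rw [Pi.smul_apply, Pi.sub_apply]
    cases v with
    | none =>
      have h2 := smul_basePlace_mem g' none
      have h3 : g' • basePlace none ∉ Place.over k (g • basePlace (some p)) := fun h =>
        Option.some_ne_none p (eq_of_mem_placesOver (over_subset_placesOver k g _ h) h2)
      rw [Set.indicator_of_mem h2, Set.indicator_of_notMem h3, sub_self, smul_zero]
    | some q =>
      have h2 : g' • basePlace (some q) ∉ placesOver none := fun h =>
        Option.some_ne_none q (eq_of_mem_placesOver (smul_basePlace_mem g' (some q)) h)
      rw [Set.indicator_of_notMem h2, sub_zero]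
      by_cases h3 : g' • basePlace (some q) ∈ Place.over k (g • basePlace (some p))
      · rw [Set.indicator_of_mem h3, hconst _ _ h3]
        exact inv_mul_cancel₀ ha0
      · rw [Set.indicator_of_notMem h3]
        have h4 : logAbs a (g' • basePlace (some q)) = 0 := ha q g' h3
        rw [h4, smul_zero]

end

/-- The functions `f_α` are dense in `X`. -/
theorem closure_FSpace : closure (FSpace : Set XSpace) = Set.univ :=
  closure_FSpace_of_forall_mem (mem_of_classMem_over isClosed_limitSpace
    fun _ _ u g => classMem_indicator_over u g)

end WeilHeight

theorem theorem6p3 (K : IntermediateField ℚ QBar) :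
    -- `S_K` is a continuous linear projection of `F` onto `D_K`
    Continuous (SOp K) ∧
    DSpace K ≤ FSpace ∧
    LinearMap.range (SOp K) = DSpace K ∧
    (∀ F : FSpace, (F : XSpace) ∈ DSpace K → SOp K F = F) ∧
    -- `F` is the direct sum of `D_K` and `E_K`
    Disjoint (DSpace K) (ESpace K) ∧
    DSpace K ⊔ ESpace K = FSpace ∧
    -- the closures are the image and the kernel of `U_K`
    closure (DSpace K : Set XSpace) = LinearMap.range (UOp K).toLinearMap ∧
    closure (ESpace K : Set XSpace) = LinearMap.ker (UOp K).toLinearMap ∧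
    -- both summands are `F`-closed
    IsFClosed (DSpace K : Set XSpace) ∧
    IsFClosed (ESpace K : Set XSpace) ∧
    -- `S_K` sends `f_β` to the average over the orbit of `β`
    (∀ β : G, (orbit K β).Finite ∧
      SOp K ⟨fVec β, fVec_mem β⟩ =
        ((orbit K β).ncard : ℚ)⁻¹ • ∑ᶠ γ ∈ orbit K β, fVec γ) :=
  main_of_dense closure_FSpace K
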